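/- Let $\mathbb{G}=(V,E)$ be a contextuality scenario: $V$ is a finite set and $E$ is a non-empty set of subsets of $V$ with $\bigcup_{e\in E}e=V$. A probabilistic model of $\mathbb{G}$ is a function $p:V\to[0,1]$ with $\sum_{x\in e}p(x)=1$ for all $e\in E$; let $\mathcal{G}(\mathbb{G})$ be the set of these, and assume $\mathcal{G}(\mathbb{G})\neq\emptyset$. A positive operator representation (POR) of $\mathbb{G}$ on a Hilbert space $H$ is a family $(A_x)_{x\in V}$ of positive operators in $\mathcal{B}(H)$ with $\sum_{x\in e}A_x=I$ for all $e\in E$; it is a projective representation (PR) if every $A_x$ is a projection. A POR $(A_x)_{x\in V}$ on $H$ is dilatable if there are a Hilbert space $K$, a PR $(P_x)_{x\in V}$ of $\mathbb{G}$ on $K$ and an isometry $W:H\to K$ with $A_x=W^*P_xW$ for all $x\in V$. The scenario $\mathbb{G}$ is dilating if each of its POR's is dilatable. Let $\mathcal{S}=\bigoplus_{e\in E}\ell^\infty_e$, where $\ell^\infty_e=\mathbb{C}^e$, let $$\tilde{\mathcal{J}}=\Big\{u=(u^e_x)_{e\in E,\,x\in e}\in\mathcal{S}:\ \sum_{e\in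 E}\sum_{x\in e}p(x)u^e_x=0\ \text{ for all } p\in\mathcal{G}(\mathbb{G})\Big\},$$ and let $\mathcal{S}_{\mathbb{G}}=\mathcal{S}/\tilde{\mathcal{J}}$ be the operator system quotient; thus a matrix $U\in M_n(\mathcal{S}_{\mathbb{G}})$ is positive if and only if, for every $\varepsilon>0$, $U+\varepsilon(I_n\otimes 1)$ has a positive lift in $M_n(\mathcal{S})$. For $x\in V$ let $a_x=|E|\,(\delta^e_x+\tilde{\mathcal{J}})\in\mathcal{S}_{\mathbb{G}}$, where $e$ is any edge containing $x$ and $\delta^e_x$ is the corresponding canonical basis vector of $\ell^\infty_e\subseteq\mathcal{S}$ (the choice of $e$ does not matter). Let $C^*(\mathbb{G})$ be the universal unital C*-algebra generated by projections $p_x$, $x\in V$, subject to the relations $\sum_{x\in e}p_x=1$, $e\in E$, and let $\mathcal{T}_{\mathbb{G}}=\mathrm{span}\{p_x:x\in V\}\subseteq C^*(\mathbb{G})$ with the inherited unit and matricial cones. Let $\Phi:\mathcal{S}_{\mathbb{G}}\to\mathcal{T}_{\mathbb{G}}$ be the (well-defined) linear map with $\Phi(a_x)=p_x$, $x\in V$.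 A complete order isomorphism is a completely positive linear bijection whose inverse is completely positive. Then: 1. $\mathbb{G}$ is dilating if and only if $\Phi:\mathcal{S}_{\mathbb{G}}\to\mathcal{T}_{\mathbb{G}}$ is a complete order isomorphism. 2. For every Hilbert space $H$: if $\phi:\mathcal{T}_{\mathbb{G}}\to\mathcal{B}(H)$ is a unital completely positive map, then $(\phi(p_x))_{x\in V}$ is a dilatable POR of $\mathbb{G}$; conversely, if $(A_x)_{x\in V}\subseteq\mathcal{B}(H)$ is a dilatable POR of $\mathbb{G}$, then there is a unique unital completely positive map $\phi:\mathcal{T}_{\mathbb{G}}\to\mathcal{B}(H)$ with $\phi(p_x)=A_x$ for all $x\in V$. -/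

import Mathlib

open scoped InnerProductSpace

universe u

noncomputable section

/-! ### Contextuality scenarios and their operator representations -/

/-- A contextuality scenario on a finite vertex set `V`: a non-empty set of subsets of `V`
(the edges, or measurements) whose union is `V`. -/
structure ContextualityScenario (V : Type u) [Fintype V] where
  edges : Finset (Finset V)
  edges_nonempty : edges.Nonempty
  covers : ∀ x : V, ∃ e ∈ edges, x ∈ e

namespace ContextualityScenario

section Representations

variable {V : Type u} [Fintype V] (G : ContextualityScenario V)

/-- The probabilistic models of `G`. -/
def probModels : Set (V → ℝ) :=
  {p | (∀ x, p x ∈ Set.Icc (0 : ℝ) 1) ∧ ∀ e ∈ G.edges, ∑ x ∈ e, p x = 1}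

/-- `G` is non-trivial if it admits a probabilistic model. -/
def IsNontrivial : Prop := G.probModels.Nonempty

variable {H : Type*} [NormedAddCommGroup H] [InnerProductSpace ℂ H] [CompleteSpace H]

/-- Positive operator representations (POR's) of `G` on the Hilbert space `H`. -/
structure IsPOR (A : V → H →L[ℂ] H) : Prop where
  pos : ∀ x, (A x).IsPositive
  sum_eq : ∀ e ∈ G.edges, ∑ x ∈ e, A x = 1

/-- Projective representations (PR's) of `G` on the Hilbert space `H`. -/
structure IsPR (P : V → H →L[ℂ] H) : Prop extends G.IsPOR P where
  proj : ∀ x, IsStarProjection (P x)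

end Representations

/-- `B` (on `K`) is a dilation of `A` (on `H`): for some isometry `W : H → K` we have
`A x = W* (B x) W` for all `x`. -/
def IsDilation {V H K : Type*} [NormedAddCommGroup H] [InnerProductSpace ℂ H] [CompleteSpace H]
    [NormedAddCommGroup K] [InnerProductSpace ℂ K] [CompleteSpace K]
    (A : V → H →L[ℂ] H) (B : V → K →L[ℂ] K) : Prop :=
  ∃ W : H →ₗᵢ[ℂ] K, ∀ x, A x =
    (ContinuousLinearMap.adjoint W.toContinuousLinearMap) ∘L (B x) ∘L W.toContinuousLinearMap

variable {V : Type u} [Fintype V] (G : ContextualityScenario V)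

/-- A dilatable POR: a POR that admits a dilation to a PR. -/
def IsDilatablePOR {H : Type u} [NormedAddCommGroup H] [InnerProductSpace ℂ H] [CompleteSpace H]
    (A : V → H →L[ℂ] H) : Prop :=
  G.IsPOR A ∧ ∃ (K : Type u) (_ : NormedAddCommGroup K) (_ : InnerProductSpace ℂ K)
    (_ : CompleteSpace K) (P : V → K →L[ℂ] K), G.IsPR P ∧ IsDilation A P

/-- `G` is dilating if every POR of `G` dilates to a PR of `G`. -/
def IsDilating : Prop :=
  ∀ (H : Type u) [NormedAddCommGroup H] [InnerProductSpace ℂ H] [CompleteSpace H]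
    (A : V → H →L[ℂ] H), G.IsPOR A → G.IsDilatablePOR A

/-! ### The free hypergraph C*-algebra `C*(G)`

`C*(G)` is the (Hausdorff) completion of the free complex *-algebra on self-adjoint generators
`x ∈ V` in the C*-seminorm `‖a‖ = sup ‖a(P)‖`, the supremum being over all PR's `P` of `G`. -/

/-- The free unital complex algebra on `V`, to be given the conjugate-linear involution fixing
the generators and the universal C*-seminorm of `G`. -/
def PreAlg (_G : ContextualityScenario V) : Type u := FreeAlgebra ℂ V

instance : Ring G.PreAlg := inferInstanceAs (Ring (FreeAlgebra ℂ V))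
instance : Algebra ℂ G.PreAlg := inferInstanceAs (Algebra ℂ (FreeAlgebra ℂ V))

/-- The free generators. -/
def gen (x : V) : G.PreAlg := FreeAlgebra.ι ℂ x

/-- The opposite algebra with conjugated scalars, the target of the involution. -/
def ConjOp : Type u := (G.PreAlg)ᵐᵒᵖ

instance : Ring G.ConjOp := inferInstanceAs (Ring (G.PreAlg)ᵐᵒᵖ)
instance : Algebra ℂ G.ConjOp :=
  RingHom.toAlgebra' ((algebraMap ℂ (G.PreAlg)ᵐᵒᵖ).comp (starRingEnd ℂ))
    (fun c x => Algebra.commutes (R := ℂ) (A := (G.PreAlg)ᵐᵒᵖ) (starRingEnd ℂ c) x)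

lemma preAlg_induction {motive : G.PreAlg → Prop}
    (h1 : ∀ c : ℂ, motive (algebraMap ℂ G.PreAlg c)) (h2 : ∀ x, motive (G.gen x))
    (h3 : ∀ a b, motive a → motive b → motive (a * b))
    (h4 : ∀ a b, motive a → motive b → motive (a + b)) (a : G.PreAlg) : motive a :=
  FreeAlgebra.induction ℂ V (motive := motive) h1 h2 h3 h4 a

/-- The involution as a homomorphism into the conjugate opposite algebra. -/
def starHom : G.PreAlg →ₐ[ℂ] G.ConjOp :=
  FreeAlgebra.lift ℂ (A := G.ConjOp) (fun x => MulOpposite.op (G.gen x))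

/-- The conjugate-linear, anti-multiplicative map fixing the generators. -/
def preStar (a : G.PreAlg) : G.PreAlg := MulOpposite.unop (α := G.PreAlg) (G.starHom a)

lemma preStar_gen (x : V) : G.preStar (G.gen x) = G.gen x :=
  congrArg (MulOpposite.unop (α := G.PreAlg))
    (FreeAlgebra.lift_ι_apply (A := G.ConjOp) (fun y => MulOpposite.op (G.gen y)) x)

lemma preStar_algebraMap (c : ℂ) :
    G.preStar (algebraMap ℂ G.PreAlg c) = algebraMap ℂ G.PreAlg (star c) :=
  congrArg (MulOpposite.unop (α := G.PreAlg)) (G.starHom.commutes c)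

lemma preStar_mul (a b : G.PreAlg) : G.preStar (a * b) = G.preStar b * G.preStar a :=
  congrArg (MulOpposite.unop (α := G.PreAlg)) (map_mul G.starHom a b)

lemma preStar_add (a b : G.PreAlg) : G.preStar (a + b) = G.preStar a + G.preStar b :=
  congrArg (MulOpposite.unop (α := G.PreAlg)) (map_add G.starHom a b)

instance : StarRing G.PreAlg where
  star := G.preStar
  star_involutive a := by
    refine G.preAlg_induction (motive := fun a => G.preStar (G.preStar a) = a) ?_ ?_ ?_ ?_ a
    · intro c; rw [preStar_algebraMap, preStar_algebraMap, star_star]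
    · intro x; rw [preStar_gen, preStar_gen]
    · intro a b ha hb; rw [preStar_mul, preStar_mul, ha, hb]
    · intro a b ha hb; rw [preStar_add, preStar_add, ha, hb]
  star_mul := G.preStar_mul
  star_add := G.preStar_add

lemma star_gen (x : V) : star (G.gen x) = G.gen x := G.preStar_gen x

lemma star_algebraMap' (c : ℂ) :
    star (algebraMap ℂ G.PreAlg c) = algebraMap ℂ G.PreAlg (star c) := G.preStar_algebraMap c

instance : StarModule ℂ G.PreAlg where
  star_smul c a := by
    rw [Algebra.smul_def, star_mul, star_algebraMap', ← Algebra.commutes, ← Algebra.smul_def]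

section Eval

variable {H : Type*} [NormedAddCommGroup H] [InnerProductSpace ℂ H]

/-- Evaluation of a free polynomial at a family of operators. -/
def eval (P : V → H →L[ℂ] H) : G.PreAlg →ₐ[ℂ] (H →L[ℂ] H) := FreeAlgebra.lift ℂ P

lemma eval_gen (P : V → H →L[ℂ] H) (x : V) : G.eval P (G.gen x) = P x :=
  FreeAlgebra.lift_ι_apply _ _

variable {G} in
lemma IsPR.eval_star [CompleteSpace H] {P : V → H →L[ℂ] H} (hP : G.IsPR P) (a : G.PreAlg) :
    G.eval P (star a) = star (G.eval P a) := by
  refine G.preAlg_induction (motive := fun a => G.eval P (star a) = star (G.eval P a))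
    ?_ ?_ ?_ ?_ a
  · intro c
    rw [star_algebraMap', AlgHom.commutes, AlgHom.commutes, algebraMap_star_comm]
  · intro x; rw [star_gen, eval_gen, (hP.proj x).isSelfAdjoint.star_eq]
  · intro a b ha hb; simp only [star_mul, map_mul, ha, hb]
  · intro a b ha hb; simp only [star_add, map_add, ha, hb]

end Eval

/-- The norms of `a` in the PR's of `G`. -/
def normSet (a : G.PreAlg) : Set ℝ :=
  {r | ∃ (H : Type u) (_ : NormedAddCommGroup H) (_ : InnerProductSpace ℂ H)
    (_ : CompleteSpace H) (P : V → H →L[ℂ] H), G.IsPR P ∧ r = ‖G.eval P a‖}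

lemma bddAbove_normSet (a : G.PreAlg) : BddAbove (G.normSet a) := by
  suffices h : ∃ C : ℝ, ∀ (H : Type u) [NormedAddCommGroup H] [InnerProductSpace ℂ H]
      [CompleteSpace H] (P : V → H →L[ℂ] H), G.IsPR P → ‖G.eval P a‖ ≤ C by
    obtain ⟨C, hC⟩ := h
    refine ⟨C, ?_⟩
    rintro r ⟨H, _, _, _, P, hP, rfl⟩
    exact hC H P hP
  refine G.preAlg_induction (motive := fun a => ∃ C : ℝ, ∀ (H : Type u) [NormedAddCommGroup H]
    [InnerProductSpace ℂ H] [CompleteSpace H] (P : V → H →L[ℂ] H), G.IsPR P →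
    ‖G.eval P a‖ ≤ C) ?_ ?_ ?_ ?_ a
  · intro c
    refine ⟨‖c‖, fun H _ _ _ P _ => ?_⟩
    rw [AlgHom.commutes, Algebra.algebraMap_eq_smul_one, norm_smul]
    exact mul_le_of_le_one_right (norm_nonneg _) ContinuousLinearMap.norm_id_le
  · intro x
    refine ⟨1, fun H _ _ _ P hP => ?_⟩
    rw [eval_gen]
    exact (hP.proj x).norm_le
  · rintro a b ⟨C, hC⟩ ⟨D, hD⟩
    refine ⟨C * D, fun H _ _ _ P hP => ?_⟩
    rw [map_mul]
    exact (norm_mul_le _ _).trans (mul_le_mul (hC H P hP) (hD H P hP) (norm_nonneg _)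
      ((norm_nonneg _).trans (hC H P hP)))
  · rintro a b ⟨C, hC⟩ ⟨D, hD⟩
    refine ⟨C + D, fun H _ _ _ P hP => ?_⟩
    rw [map_add]
    exact (norm_add_le _ _).trans (add_le_add (hC H P hP) (hD H P hP))

/-- The universal C*-seminorm of `G`. -/
def preNorm (a : G.PreAlg) : ℝ := sSup (G.normSet a)

lemma preNorm_nonneg (a : G.PreAlg) : 0 ≤ G.preNorm a := by
  apply Real.sSup_nonneg
  rintro r ⟨H, _, _, _, P, hP, rfl⟩
  exact norm_nonneg _

variable {G} in
lemma IsPR.norm_eval_le {H : Type u} [NormedAddCommGroup H] [InnerProductSpace ℂ H]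
    [CompleteSpace H] {P : V → H →L[ℂ] H} (hP : G.IsPR P) (a : G.PreAlg) :
    ‖G.eval P a‖ ≤ G.preNorm a :=
  le_csSup (G.bddAbove_normSet a) ⟨H, _, _, _, P, hP, rfl⟩

lemma preNorm_le {a : G.PreAlg} {C : ℝ} (hC : 0 ≤ C)
    (h : ∀ (H : Type u) [NormedAddCommGroup H] [InnerProductSpace ℂ H]
      [CompleteSpace H] (P : V → H →L[ℂ] H), G.IsPR P → ‖G.eval P a‖ ≤ C) :
    G.preNorm a ≤ C := by
  apply Real.sSup_le _ hC
  rintro r ⟨H, _, _, _, P, hP, rfl⟩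
  exact h H P hP

/-- The universal C*-seminorm as a ring seminorm. -/
def preRingSeminorm : RingSeminorm G.PreAlg where
  toFun := G.preNorm
  map_zero' := le_antisymm (G.preNorm_le le_rfl (fun H _ _ _ P _ => by simp)) (G.preNorm_nonneg _)
  add_le' a b := G.preNorm_le (add_nonneg (G.preNorm_nonneg _) (G.preNorm_nonneg _))
    (fun H _ _ _ P hP => by
      rw [map_add]
      exact (norm_add_le _ _).trans (add_le_add (hP.norm_eval_le a) (hP.norm_eval_le b)))
  neg' a := by simp [preNorm, normSet]
  mul_le' a b := G.preNorm_le (mul_nonneg (G.preNorm_nonneg _) (G.preNorm_nonneg _))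
    (fun H _ _ _ P hP => by
      rw [map_mul]
      exact (norm_mul_le _ _).trans (mul_le_mul (hP.norm_eval_le a) (hP.norm_eval_le b)
        (norm_nonneg _) (G.preNorm_nonneg _)))

instance : SeminormedRing G.PreAlg := G.preRingSeminorm.toSeminormedRing

lemma norm_def (a : G.PreAlg) : ‖a‖ = G.preNorm a := rfl

instance : NormedAlgebra ℂ G.PreAlg where
  norm_smul_le c a := G.preNorm_le (mul_nonneg (norm_nonneg _) (G.preNorm_nonneg _))
    (fun H _ _ _ P hP => by
      rw [map_smul, norm_smul]
      exact mul_le_mul_of_nonneg_left (hP.norm_eval_le a) (norm_nonneg _))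

lemma preNorm_star (a : G.PreAlg) : ‖star a‖ = ‖a‖ := by
  have key : ∀ b : G.PreAlg, ‖star b‖ ≤ ‖b‖ := fun b =>
    G.preNorm_le (G.preNorm_nonneg _) (fun H _ _ _ P hP => by
      rw [hP.eval_star, norm_star]
      exact hP.norm_eval_le b)
  refine le_antisymm (key a) ?_
  simpa using key (star a)

lemma preNorm_cstar (a : G.PreAlg) : ‖a‖ * ‖a‖ ≤ ‖star a * a‖ := by
  have h : ‖a‖ ≤ √‖star a * a‖ := G.preNorm_le (Real.sqrt_nonneg _) (fun H _ _ _ P hP => by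
    apply Real.le_sqrt_of_sq_le
    have := hP.norm_eval_le (star a * a)
    rw [map_mul, hP.eval_star, CStarRing.norm_star_mul_self, ← sq] at this
    exact this)
  calc ‖a‖ * ‖a‖ ≤ √‖star a * a‖ * √‖star a * a‖ :=
        mul_self_le_mul_self (norm_nonneg _) h
    _ = ‖star a * a‖ := Real.mul_self_sqrt (norm_nonneg _)

/-- The free hypergraph C*-algebra `C*(G)`. -/
def CStar : Type u := UniformSpace.Completion G.PreAlg

instance : NormedRing G.CStar := inferInstanceAs (NormedRing (UniformSpace.Completion G.PreAlg))
instance : CompleteSpace G.CStar :=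
  inferInstanceAs (CompleteSpace (UniformSpace.Completion G.PreAlg))

instance : NormedAlgebra ℂ G.CStar where
  toAlgebra := inferInstanceAs (Algebra ℂ (UniformSpace.Completion G.PreAlg))
  norm_smul_le c a := by
    have h : ∀ (c : ℂ) (a : UniformSpace.Completion G.PreAlg), ‖c • a‖ ≤ ‖c‖ * ‖a‖ :=
      fun c a => (norm_smul c a).le
    exact h c a

/-- The canonical map of the free algebra into `C*(G)`. -/
def toCStar : G.PreAlg →ₐ[ℂ] G.CStar where
  toFun a := (a : UniformSpace.Completion G.PreAlg)
  map_one' := UniformSpace.Completion.coe_one _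
  map_mul' := UniformSpace.Completion.coe_mul
  map_zero' := UniformSpace.Completion.coe_zero
  map_add' := UniformSpace.Completion.coe_add
  commutes' _ := rfl

lemma norm_toCStar (a : G.PreAlg) : ‖G.toCStar a‖ = ‖a‖ := UniformSpace.Completion.norm_coe a

lemma denseRange_toCStar : DenseRange G.toCStar := UniformSpace.Completion.denseRange_coe

lemma isometry_star : Isometry (star : G.PreAlg → G.PreAlg) :=
  Isometry.of_dist_eq (fun a b => by rw [dist_eq_norm, ← star_sub, preNorm_star, dist_eq_norm])

instance : Star G.CStar where
  star := UniformSpace.Completion.map (star : G.PreAlg → G.PreAlg)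

lemma star_toCStar (a : G.PreAlg) : star (G.toCStar a) = G.toCStar (star a) :=
  UniformSpace.Completion.map_coe G.isometry_star.uniformContinuous a

lemma continuous_star_cstar : Continuous (star : G.CStar → G.CStar) :=
  UniformSpace.Completion.continuous_map

instance : StarRing G.CStar where
  star_involutive a := by
    refine G.denseRange_toCStar.induction_on (p := fun a => star (star a) = a) a
      (isClosed_eq (G.continuous_star_cstar.comp G.continuous_star_cstar) continuous_id) ?_
    intro a; rw [star_toCStar, star_toCStar, star_star]
  star_mul a b := by
    refine G.denseRange_toCStar.induction_on₂ (p := fun a b => star (a * b) = star b * star a)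
      ?_ ?_ a b
    · exact isClosed_eq (G.continuous_star_cstar.comp continuous_mul)
        ((G.continuous_star_cstar.comp continuous_snd).mul
          (G.continuous_star_cstar.comp continuous_fst))
    · intro a b
      simp only [← map_mul, star_toCStar, star_mul]
  star_add a b := by
    refine G.denseRange_toCStar.induction_on₂ (p := fun a b => star (a + b) = star a + star b)
      ?_ ?_ a b
    · exact isClosed_eq (G.continuous_star_cstar.comp continuous_add)
        ((G.continuous_star_cstar.comp continuous_fst).add
          (G.continuous_star_cstar.comp continuous_snd))
    · intro a b
      simp only [← map_add, star_toCStar, star_add]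

instance : StarModule ℂ G.CStar where
  star_smul c a := by
    refine G.denseRange_toCStar.induction_on (p := fun a => star (c • a) = star c • star a) a
      (isClosed_eq (G.continuous_star_cstar.comp (continuous_const_smul c))
        (G.continuous_star_cstar.const_smul (star c))) ?_
    intro a
    simp only [← map_smul, star_toCStar, star_smul]

instance : CStarRing G.CStar where
  norm_mul_self_le a := by
    refine G.denseRange_toCStar.induction_on (p := fun a => ‖a‖ * ‖a‖ ≤ ‖star a * a‖) a
      (isClosed_le (continuous_norm.mul continuous_norm)
        (continuous_norm.comp (G.continuous_star_cstar.mul continuous_id))) ?_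
    intro a
    simp only [star_toCStar, ← map_mul, norm_toCStar]
    exact G.preNorm_cstar a

instance : CStarAlgebra G.CStar where

/-- The canonical generators `p_x` of `C*(G)`. -/
def projGen (x : V) : G.CStar := G.toCStar (G.gen x)

/-- An element of the free algebra that vanishes in every PR is zero in `C*(G)`. -/
lemma toCStar_eq_zero {a : G.PreAlg}
    (h : ∀ (H : Type u) [NormedAddCommGroup H] [InnerProductSpace ℂ H]
      [CompleteSpace H] (P : V → H →L[ℂ] H), G.IsPR P → G.eval P a = 0) : G.toCStar a = 0 := by
  rw [← norm_le_zero_iff, norm_toCStar]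
  exact G.preNorm_le le_rfl (fun H _ _ _ P hP => by rw [h H P hP, norm_zero])

lemma isStarProjection_projGen (x : V) : IsStarProjection (G.projGen x) where
  isIdempotentElem := by
    have := G.toCStar_eq_zero (a := G.gen x * G.gen x - G.gen x) (fun H _ _ _ P hP => by
      rw [map_sub, map_mul, eval_gen, (hP.proj x).isIdempotentElem.eq, sub_self])
    rwa [map_sub, map_mul, sub_eq_zero] at this
  isSelfAdjoint := by
    rw [IsSelfAdjoint, projGen, star_toCStar, star_gen]

lemma sum_projGen {e : Finset V} (he : e ∈ G.edges) : ∑ x ∈ e, G.projGen x = 1 := by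
  have := G.toCStar_eq_zero (a := ∑ x ∈ e, G.gen x - 1) (fun H _ _ _ P hP => by
    rw [map_sub, map_sum, map_one, sub_eq_zero, ← hP.sum_eq e he]
    exact Finset.sum_congr rfl (fun x _ => G.eval_gen P x))
  rwa [map_sub, map_sum, map_one, sub_eq_zero] at this

/-! ### Matrix orders and complete positivity -/

/-- The positive elements of `M_n(A)` for a C*-algebra `A`: those of the form `B* B`. -/
def matPos (A : Type*) [Ring A] [StarRing A] (n : ℕ) : Set (Matrix (Fin n) (Fin n) A) :=
  {M | ∃ B : Matrix (Fin n) (Fin n) A, M = B.conjTranspose * B}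

/-- Complete positivity of a linear map with respect to given families of matricial cones. -/
def IsCP {S T : Type*} [AddCommGroup S] [Module ℂ S] [AddCommGroup T] [Module ℂ T]
    (C : ∀ n, Set (Matrix (Fin n) (Fin n) S)) (D : ∀ n, Set (Matrix (Fin n) (Fin n) T))
    (φ : S →ₗ[ℂ] T) : Prop :=
  ∀ n, ∀ M ∈ C n, M.map φ ∈ D n

/-- Complete order isomorphisms: completely positive bijections with completely positive
inverse. -/
def IsCompleteOrderIso {S T : Type*} [AddCommGroup S] [Module ℂ S] [AddCommGroup T] [Module ℂ T]
    (C : ∀ n, Set (Matrix (Fin n) (Fin n) S)) (D : ∀ n, Set (Matrix (Fin n) (Fin n) T))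
    (φ : S →ₗ[ℂ] T) : Prop :=
  IsCP C D φ ∧ ∃ ψ : T →ₗ[ℂ] S, ψ ∘ₗ φ = LinearMap.id ∧ φ ∘ₗ ψ = LinearMap.id ∧ IsCP D C ψ

/-! ### The operator system `T_G ⊆ C*(G)` -/

/-- The linear span of the generators of `C*(G)`. -/
def TSys : Submodule ℂ G.CStar := Submodule.span ℂ (Set.range G.projGen)

/-- The generators `p_x` as elements of `T_G`. -/
def tGen (x : V) : G.TSys := ⟨G.projGen x, Submodule.subset_span ⟨x, rfl⟩⟩

lemma one_mem_TSys : (1 : G.CStar) ∈ G.TSys := by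
  obtain ⟨e, he⟩ := G.edges_nonempty
  rw [← G.sum_projGen he]
  exact Submodule.sum_mem _ (fun x _ => (G.tGen x).2)

/-- The unit of `T_G`. -/
def tOne : G.TSys := ⟨1, G.one_mem_TSys⟩

/-- The matricial cones that `T_G` inherits from `C*(G)`. -/
def tCone (n : ℕ) : Set (Matrix (Fin n) (Fin n) G.TSys) :=
  {M | M.map Subtype.val ∈ matPos G.CStar n}

/-! ### The operator system `S_G` -/

/-- The C*-algebra `⊕_{e ∈ E} ℓ^∞_e`. -/
abbrev EdgeAlg : Type u := (e : G.edges) → (e.1 → ℂ)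

/-- The functional `u ↦ ⟨p, u⟩ = ∑_{e ∈ E} ∑_{x ∈ e} p(x) u_x^e`. -/
def pairing (p : V → ℝ) : G.EdgeAlg →ₗ[ℂ] ℂ where
  toFun u := ∑ e : G.edges, ∑ x : e.1, (p x : ℂ) * u e x
  map_add' u v := by simp [mul_add, Finset.sum_add_distrib]
  map_smul' c u := by simp [Finset.mul_sum, mul_left_comm]

/-- The kernel `{u : ⟨p, u⟩ = 0 for all probabilistic models p}`. -/
def edgeKernel : Submodule ℂ G.EdgeAlg := ⨅ p ∈ G.probModels, LinearMap.ker (G.pairing p)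

lemma mem_edgeKernel {u : G.EdgeAlg} :
    u ∈ G.edgeKernel ↔ ∀ p ∈ G.probModels, G.pairing p u = 0 := by
  simp [edgeKernel, Submodule.mem_iInf]

/-- The universal operator system `S_G` as a vector space. -/
abbrev SSys : Type u := G.EdgeAlg ⧸ G.edgeKernel

/-- The unit of `S_G`. -/
def sOne : G.SSys := G.edgeKernel.mkQ 1

/-- The matricial cones of the operator system quotient: `U ∈ M_n(S_G)` is positive if, for
every `ε > 0`, the element `U + ε 1` lifts to a positive matrix over `⊕_e ℓ^∞_e`. -/
def sCone (n : ℕ) : Set (Matrix (Fin n) (Fin n) G.SSys) :=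
  {U | ∀ ε : ℝ, 0 < ε → ∃ M ∈ matPos G.EdgeAlg n,
    M.map G.edgeKernel.mkQ = U + Matrix.diagonal (fun _ => (ε : ℂ) • G.sOne)}

open Classical in
/-- The element `δ_x^e` of `ℓ^∞_e ⊆ ⊕_f ℓ^∞_f`. -/
def edgeDelta (e : G.edges) (x : e.1) : G.EdgeAlg := Pi.single e (Pi.single x 1)

/-- The generators `a_x = |E| (δ_x^e + kernel)` of `S_G`, for any edge `e` containing `x`. -/
def sGen (x : V) : G.SSys :=
  (G.edges.card : ℂ) • G.edgeKernel.mkQ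
    (G.edgeDelta ⟨(G.covers x).choose, (G.covers x).choose_spec.1⟩
      ⟨x, (G.covers x).choose_spec.2⟩)

lemma pairing_edgeDelta (p : V → ℝ) (e : G.edges) (x : e.1) :
    G.pairing p (G.edgeDelta e x) = p x := by
  classical
  change ∑ f : G.edges, ∑ y : f.1, (p y : ℂ) * G.edgeDelta e x f y = p x
  rw [Finset.sum_eq_single e]
  · rw [Finset.sum_eq_single x]
    · simp [edgeDelta]
    · intro y _ hy; simp [edgeDelta, hy]
    · simp
  · intro f _ hf
    simp [edgeDelta, hf]
  · simp

/-- `a_x` does not depend on the edge used to define it. -/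
lemma sGen_eq (e : G.edges) (x : e.1) :
    G.sGen x = (G.edges.card : ℂ) • G.edgeKernel.mkQ (G.edgeDelta e x) := by
  unfold sGen
  congr 1
  rw [← sub_eq_zero, ← map_sub, Submodule.mkQ_apply, Submodule.Quotient.mk_eq_zero,
    mem_edgeKernel]
  intro p _
  rw [map_sub, pairing_edgeDelta, pairing_edgeDelta, sub_self]

/-! ### The canonical map `Φ : S_G → T_G` -/

/-- The map `⊕_e ℓ^∞_e → T_G`, `u ↦ |E|⁻¹ ∑_e ∑_{x ∈ e} u_x^e p_x`. -/
def preCanonicalMap : G.EdgeAlg →ₗ[ℂ] G.TSys where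
  toFun u := (G.edges.card : ℂ)⁻¹ • ∑ e : G.edges, ∑ x : e.1, u e x • G.tGen x
  map_add' u v := by simp [add_smul, Finset.sum_add_distrib]
  map_smul' c u := by simp [Finset.smul_sum, smul_smul, mul_left_comm]

lemma IsPOR.probModel {H : Type*} [NormedAddCommGroup H] [InnerProductSpace ℂ H]
    [CompleteSpace H] {G : ContextualityScenario V} {A : V → H →L[ℂ] H} (hA : G.IsPOR A)
    {ξ : H} (hξ : ‖ξ‖ = 1) : (fun x => (⟪A x ξ, ξ⟫_ℂ).re) ∈ G.probModels := by
  have hsum : ∀ e ∈ G.edges, ∑ x ∈ e, (⟪A x ξ, ξ⟫_ℂ).re = 1 := by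
    intro e he
    have h := congrArg (fun T : H →L[ℂ] H => ⟪T ξ, ξ⟫_ℂ) (hA.sum_eq e he)
    simp only [sum_apply, sum_inner] at h
    rw [← Complex.re_sum, h]
    simp [inner_self_eq_norm_sq_to_K, hξ]
  have hpos : ∀ x, 0 ≤ (⟪A x ξ, ξ⟫_ℂ).re := fun x => (hA.pos x).re_inner_nonneg_left ξ
  refine ⟨fun x => ⟨hpos x, ?_⟩, hsum⟩
  obtain ⟨e, he, hx⟩ := G.covers x
  rw [← hsum e he]
  exact Finset.single_le_sum (f := fun x => (⟪A x ξ, ξ⟫_ℂ).re) (fun y _ => hpos y) hx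

lemma IsPOR.sum_eq_zero {H : Type*} [NormedAddCommGroup H] [InnerProductSpace ℂ H]
    [CompleteSpace H] {G : ContextualityScenario V} {A : V → H →L[ℂ] H} (hA : G.IsPOR A)
    {u : G.EdgeAlg} (hu : u ∈ G.edgeKernel) :
    ∑ e : G.edges, ∑ x : e.1, u e x • A x = 0 := by
  set T : H →L[ℂ] H := ∑ e : G.edges, ∑ x : e.1, u e x • A x with hT
  have hunit : ∀ ξ : H, ‖ξ‖ = 1 → ⟪ξ, T ξ⟫_ℂ = 0 := by
    intro ξ hξ
    have h := (mem_edgeKernel G).1 hu _ (hA.probModel hξ)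
    change ∑ e : G.edges, ∑ x : e.1, ((⟪A x ξ, ξ⟫_ℂ).re : ℂ) * u e x = 0 at h
    rw [← h, hT]
    simp only [sum_apply, smul_apply, inner_sum, inner_smul_right]
    refine Finset.sum_congr rfl fun e _ => Finset.sum_congr rfl fun x _ => ?_
    have hs : ⟪ξ, A x ξ⟫_ℂ = ⟪A x ξ, ξ⟫_ℂ := ((hA.pos x).isSymmetric ξ ξ).symm
    have hr : ((⟪A x ξ, ξ⟫_ℂ).re : ℂ) = ⟪A x ξ, ξ⟫_ℂ := by
      apply Complex.conj_eq_iff_re.1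
      rw [inner_conj_symm, hs]
    rw [hr, hs, mul_comm]
  have hz : (T : H →ₗ[ℂ] H) = 0 := by
    rw [← inner_map_self_eq_zero]
    intro ξ
    by_cases h0 : ξ = 0
    · simp [h0]
    have hn : (‖ξ‖ : ℂ) ≠ 0 := by simpa using h0
    have h1 := hunit ((‖ξ‖ : ℂ)⁻¹ • ξ) (by
      rw [norm_smul, norm_inv, Complex.norm_real, norm_norm, inv_mul_cancel₀ (by simpa using h0)])
    rw [map_smul, inner_smul_left, inner_smul_right] at h1
    have h2 : ⟪ξ, T ξ⟫_ℂ = 0 := by simpa [hn, h0] using h1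
    rw [← inner_conj_symm]
    simpa using congrArg (starRingEnd ℂ) h2
  exact ContinuousLinearMap.ext fun ξ => LinearMap.congr_fun hz ξ

lemma edgeKernel_le : G.edgeKernel ≤ LinearMap.ker G.preCanonicalMap := by
  intro u hu
  rw [LinearMap.mem_ker]
  have h : G.toCStar (∑ e : G.edges, ∑ x : e.1, u e x • G.gen x) = 0 :=
    G.toCStar_eq_zero (fun H _ _ _ P hP => by
      simpa [map_sum, eval_gen] using hP.toIsPOR.sum_eq_zero hu)
  have h2 : (∑ e : G.edges, ∑ x : e.1, u e x • G.tGen x) = 0 := by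
    apply Subtype.ext
    simpa [map_sum, tGen, projGen] using h
  change (G.edges.card : ℂ)⁻¹ • ∑ e : G.edges, ∑ x : e.1, u e x • G.tGen x = 0
  rw [h2, smul_zero]

/-- The canonical map `Φ : S_G → T_G`. -/
def canonicalMap : G.SSys →ₗ[ℂ] G.TSys := G.edgeKernel.liftQ G.preCanonicalMap G.edgeKernel_le

/-- `Φ` sends `a_x` to `p_x`. -/
lemma canonicalMap_sGen (x : V) : G.canonicalMap (G.sGen x) = G.tGen x := by
  classical
  obtain ⟨e, he, hx⟩ := G.covers x
  rw [G.sGen_eq ⟨e, he⟩ ⟨x, hx⟩, map_smul]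
  change (G.edges.card : ℂ) • (G.edges.card : ℂ)⁻¹ • ∑ f : G.edges, ∑ y : f.1,
    G.edgeDelta ⟨e, he⟩ ⟨x, hx⟩ f y • G.tGen y = _
  have hc : (G.edges.card : ℂ) ≠ 0 := by exact_mod_cast G.edges_nonempty.card_pos.ne'
  rw [smul_inv_smul₀ hc, Finset.sum_eq_single ⟨e, he⟩]
  · rw [Finset.sum_eq_single ⟨x, hx⟩]
    · simp [edgeDelta]
    · intro y _ hy; simp [edgeDelta, hy]
    · simp
  · intro f _ hf
    simp [edgeDelta, hf]
  · simp

/-- Unital completely positive maps from `T_G` into `B(H)`. -/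
def IsUCP {H : Type*} [NormedAddCommGroup H] [InnerProductSpace ℂ H] [CompleteSpace H]
    (φ : G.TSys →ₗ[ℂ] (H →L[ℂ] H)) : Prop :=
  φ G.tOne = 1 ∧ IsCP G.tCone (matPos (H →L[ℂ] H)) φ

end ContextualityScenario

end

/-!
A *-representation of `C*(G)` is the same as a PR of `G`. A unital completely positive map on `T_G`
is a compression of such a representation: it induces a functional on finitely supported kernels
over `T_G`, which the Riesz extension theorem extends to a positive functional on kernels over
`C*(G)`, and the Gelfand–Naimark–Segal construction turns the latter into the dilation. Hence the
dilatable PORs of `G` are the unital completely positive maps on `T_G`, while all PORs are those on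
`S_G`; so `G` is dilating as soon as `Φ` is a complete order isomorphism.

Conversely, let `G` be dilating, and suppose that a matrix over `S_G` is positive in `T_G` but not
in `S_G`. Separate a lift of it from the cone of liftable matrices by a functional. Such a
functional comes from a linear map `S_G → B(ℂⁿ)` that is positive on the generators. After adding
`δ` times a probabilistic model and normalising, this map is a POR, so it factors through `T_G` and
the functional is nonnegative on the given matrix, a contradiction.
-/

noncomputable section

namespace ContextualityScenario

/-! ### Positive matrices over a star ring -/

section MatPos

variable {A : Type*} {n : ℕ}

section StarRing

variable [Ring A] [StarRing A] {M : Matrix (Fin n) (Fin n) A}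

lemma zero_mem_matPos : (0 : Matrix (Fin n) (Fin n) A) ∈ matPos A n := ⟨0, by simp⟩

lemma conjTranspose_eq_of_mem_matPos (hM : M ∈ matPos A n) : M.conjTranspose = M := by
  obtain ⟨B, rfl⟩ := hM
  rw [Matrix.conjTranspose_mul, Matrix.conjTranspose_conjTranspose]

lemma smul_mem_matPos [Algebra ℂ A] [StarModule ℂ A] {r : ℝ} (hr : 0 ≤ r)
    (hM : M ∈ matPos A n) : (r : ℂ) • M ∈ matPos A n := by
  obtain ⟨B, rfl⟩ := hM
  refine ⟨((√r : ℝ) : ℂ) • B, ?_⟩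
  rw [Matrix.conjTranspose_smul, Matrix.smul_mul, Matrix.mul_smul, smul_smul,
    Complex.star_def, Complex.conj_ofReal, ← Complex.ofReal_mul, Real.mul_self_sqrt hr]

lemma star_mul_mem_matPos (b : Fin n → A) :
    Matrix.of (fun i j => star (b i) * b j) ∈ matPos A n := by
  rcases n with _ | n
  · exact ⟨0, Subsingleton.elim _ _⟩
  · refine ⟨Matrix.of fun k j => if k = 0 then b j else 0, ?_⟩
    ext i j
    simp [Matrix.mul_apply, apply_ite star]

end StarRing

variable [CStarAlgebra A] {M N : Matrix (Fin n) (Fin n) A}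

-- Mathlib's version asks for the functional calculus of `A`, an instance that is not found
-- directly for `CStarMatrix (Fin n) (Fin n) A`.
lemma nonneg_iff_exists_eq_star_mul_self [PartialOrder A] [StarOrderedRing A] {a : A} :
    0 ≤ a ↔ ∃ b, a = star b * b :=
  CStarAlgebra.nonneg_iff_eq_star_mul_self

lemma mem_matPos_iff_nonneg [PartialOrder A] [StarOrderedRing A] :
    M ∈ matPos A n ↔ 0 ≤ CStarMatrix.ofMatrix M := by
  rw [nonneg_iff_exists_eq_star_mul_self]
  exact Iff.rfl

lemma add_mem_matPos (hM : M ∈ matPos A n) (hN : N ∈ matPos A n) : M + N ∈ matPos A n := by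
  let _ := CStarAlgebra.spectralOrder A
  have _ := CStarAlgebra.spectralOrderedRing A
  rw [mem_matPos_iff_nonneg] at hM hN ⊢
  exact add_nonneg hM hN

lemma sum_mem_matPos {ι : Type*} (s : Finset ι) {M : ι → Matrix (Fin n) (Fin n) A}
    (hM : ∀ i ∈ s, M i ∈ matPos A n) : ∑ i ∈ s, M i ∈ matPos A n :=
  Finset.sum_induction _ (· ∈ matPos A n) (fun _ _ => add_mem_matPos) zero_mem_matPos hM

lemma isClosed_matPos : IsClosed (matPos A n) := by
  let _ := CStarAlgebra.spectralOrder A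
  have _ := CStarAlgebra.spectralOrderedRing A
  have hpre : matPos A n =
      CStarMatrix.ofMatrixL (m := Fin n) (n := Fin n) (A := A) ⁻¹' {M | 0 ≤ M} :=
    Set.ext fun _ => mem_matPos_iff_nonneg
  rw [hpre]
  exact CStarAlgebra.isClosed_nonneg.preimage (ContinuousLinearEquiv.continuous _)

lemma mem_matPos_of_forall_add_smul_mem {N : Matrix (Fin n) (Fin n) A}
    (h : ∀ ε : ℝ, 0 < ε → M + (ε : ℂ) • N ∈ matPos A n) : M ∈ matPos A n := by
  have hcont : Continuous fun ε : ℝ => M + (ε : ℂ) • N := by fun_prop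
  refine isClosed_matPos.mem_of_tendsto (b := nhdsWithin (0 : ℝ) (Set.Ioi 0))
    ((hcont.tendsto' 0 M (by simp)).mono_left nhdsWithin_le_nhds) ?_
  filter_upwards [self_mem_nhdsWithin] with ε hε using h ε hε

lemma add_diagonal_mem_matPos_of_norm_le [PartialOrder A] [StarOrderedRing A] {ε : ℝ}
    (hM : M.conjTranspose = M) (hnorm : ‖CStarMatrix.ofMatrixL M‖ ≤ ε) :
    M + Matrix.diagonal (fun _ => (ε : ℂ) • (1 : A)) ∈ matPos A n := by
  have hsa : IsSelfAdjoint (CStarMatrix.ofMatrixL M) := hM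
  have hnorm' := algebraMap_mono (CStarMatrix (Fin n) (Fin n) A) hnorm
  have hnonneg : 0 ≤ CStarMatrix.ofMatrixL M + algebraMap ℝ _ ε :=
    (neg_le_iff_add_nonneg.1 hsa.neg_algebraMap_norm_le_self).trans (add_le_add_right hnorm' _)
  rw [mem_matPos_iff_nonneg]
  convert hnonneg using 1
  ext i j
  rw [CStarMatrix.add_apply, Algebra.algebraMap_eq_smul_one, CStarMatrix.smul_apply]
  change M i j + Matrix.diagonal (fun _ => (ε : ℂ) • (1 : A)) i j =
    M i j + ε • (1 : Matrix (Fin n) (Fin n) A) i j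
  rw [Matrix.diagonal_apply, Matrix.one_apply]
  split_ifs <;> simp

lemma eventually_add_conjTranspose_add_diagonal_mem_matPos {ε : ℝ} (hε : 0 < ε) :
    ∀ᶠ N in nhds (0 : Matrix (Fin n) (Fin n) A),
      N + N.conjTranspose + Matrix.diagonal (fun _ => (ε : ℂ) • (1 : A)) ∈ matPos A n := by
  let _ := CStarAlgebra.spectralOrder A
  have _ := CStarAlgebra.spectralOrderedRing A
  have hcont : Continuous fun N : Matrix (Fin n) (Fin n) A =>
      ‖CStarMatrix.ofMatrixL (N + N.conjTranspose)‖ :=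
    continuous_norm.comp ((ContinuousLinearEquiv.continuous _).comp
      (continuous_id.add continuous_id.matrix_conjTranspose))
  filter_upwards [hcont.tendsto' 0 0 (by simp) |>.eventually (gt_mem_nhds hε)] with N hN
  refine add_diagonal_mem_matPos_of_norm_le ?_ hN.le
  rw [Matrix.conjTranspose_add, Matrix.conjTranspose_conjTranspose, add_comm]

end MatPos

lemma exists_norm_sq_smul_one_sub_eq_star_mul_self {A : Type*} [CStarAlgebra A] (a : A) :
    ∃ b : A, ((‖a‖ ^ 2 : ℝ) : ℂ) • (1 : A) - star a * a = star b * b := by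
  let _ := CStarAlgebra.spectralOrder A
  have _ := CStarAlgebra.spectralOrderedRing A
  have hle := CStarAlgebra.star_mul_le_algebraMap_norm_sq (a := a)
  rw [Algebra.algebraMap_eq_smul_one] at hle
  refine nonneg_iff_exists_eq_star_mul_self.1 ?_
  rwa [sub_nonneg, Complex.coe_smul]

lemma IsCP.comp {R S T : Type*} [AddCommGroup R] [Module ℂ R] [AddCommGroup S] [Module ℂ S]
    [AddCommGroup T] [Module ℂ T] {B : ∀ n, Set (Matrix (Fin n) (Fin n) R)}
    {C : ∀ n, Set (Matrix (Fin n) (Fin n) S)} {D : ∀ n, Set (Matrix (Fin n) (Fin n) T)}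
    {ψ : S →ₗ[ℂ] T} {φ : R →ₗ[ℂ] S} (hψ : IsCP C D ψ) (hφ : IsCP B C φ) :
    IsCP B D (ψ ∘ₗ φ) :=
  fun n M hM => hψ n _ (hφ n M hM)

lemma isCP_starAlgHom {A B : Type*} [Ring A] [StarRing A] [Algebra ℂ A] [Ring B] [StarRing B]
    [Algebra ℂ B] (π : A →⋆ₐ[ℂ] B) :
    IsCP (matPos A) (matPos B) (π : A →ₐ[ℂ] B).toLinearMap := by
  rintro n _ ⟨B, rfl⟩
  refine ⟨B.map π, ?_⟩
  ext i j
  simp [Matrix.mul_apply, map_star]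

/-! ### Positive matrices of operators -/

section Operators

variable {H : Type*} [NormedAddCommGroup H] [InnerProductSpace ℂ H] {n : ℕ}

open scoped ComplexOrder

lemma isPositive_iff_forall_inner_nonneg {T : H →L[ℂ] H} :
    T.IsPositive ↔ ∀ ξ, 0 ≤ ⟪ξ, T ξ⟫_ℂ := by
  refine ⟨fun h => h.inner_nonneg_right, fun h => ?_⟩
  rw [ContinuousLinearMap.isPositive_iff_complex]
  intro ξ
  have hξ : ⟪T ξ, ξ⟫_ℂ = ⟪ξ, T ξ⟫_ℂ := by
    rw [← inner_conj_symm, Complex.conj_eq_iff_im, ← (Complex.nonneg_iff.1 (h ξ)).2]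
  rw [hξ]
  exact ⟨(Complex.eq_re_of_ofReal_le (h ξ)).symm, (Complex.nonneg_iff.1 (h ξ)).1⟩

/-- The operator on `Hⁿ = PiLp 2 (fun _ => H)` with matrix `M`. -/
def blockOperator (M : Matrix (Fin n) (Fin n) (H →L[ℂ] H)) :
    PiLp 2 (fun _ : Fin n => H) →L[ℂ] PiLp 2 (fun _ : Fin n => H) :=
  (PiLp.continuousLinearEquiv 2 ℂ (fun _ : Fin n => H)).symm.toContinuousLinearMap ∘L
    ContinuousLinearMap.pi fun i => ∑ j, M i j ∘L PiLp.proj 2 (fun _ : Fin n => H) j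

lemma inner_blockOperator (M : Matrix (Fin n) (Fin n) (H →L[ℂ] H))
    (ξ η : PiLp 2 (fun _ : Fin n => H)) :
    ⟪ξ, blockOperator M η⟫_ℂ = ∑ i, ∑ j, ⟪ξ i, M i j (η j)⟫_ℂ := by
  simp [PiLp.inner_apply, blockOperator, inner_sum]

lemma inner_single_blockOperator_single (M : Matrix (Fin n) (Fin n) (H →L[ℂ] H)) (i j : Fin n)
    (ξ η : H) :
    ⟪PiLp.single 2 i ξ, blockOperator M (PiLp.single 2 j η)⟫_ℂ = ⟪ξ, M i j η⟫_ℂ := by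
  rw [inner_blockOperator, Finset.sum_eq_single i, Finset.sum_eq_single j]
  · simp
  · intro l _ hl
    simp [hl]
  · simp
  · intro k _ hk
    simp [hk]
  · simp

variable [CompleteSpace H]

lemma inner_conjTranspose_mul_self_apply (B : Matrix (Fin n) (Fin n) (H →L[ℂ] H)) (i j : Fin n)
    (ξ η : H) : ⟪ξ, (B.conjTranspose * B) i j η⟫_ℂ = ∑ k, ⟪B k i ξ, B k j η⟫_ℂ := by
  simp only [Matrix.mul_apply, Matrix.conjTranspose_apply, sum_apply, inner_sum,
    mul_apply_eq_comp, ContinuousLinearMap.star_eq_adjoint,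
    ContinuousLinearMap.adjoint_inner_right]

lemma mem_matPos_of_isPositive_blockOperator {M : Matrix (Fin n) (Fin n) (H →L[ℂ] H)}
    (hM : (blockOperator M).IsPositive) : M ∈ matPos (H →L[ℂ] H) n := by
  obtain ⟨S, hS⟩ := nonneg_iff_exists_eq_star_mul_self.1
    ((ContinuousLinearMap.nonneg_iff_isPositive _).2 hM)
  let inj (j : Fin n) : H →L[ℂ] PiLp 2 (fun _ : Fin n => H) :=
    (PiLp.continuousLinearEquiv 2 ℂ (fun _ : Fin n => H)).symm.toContinuousLinearMap ∘L
      ContinuousLinearMap.single ℂ (fun _ : Fin n => H) j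
  refine ⟨Matrix.of fun k j => PiLp.proj 2 (fun _ : Fin n => H) k ∘L S ∘L inj j, ?_⟩
  ext i j η
  refine ext_inner_left ℂ fun ξ => ?_
  rw [inner_conjTranspose_mul_self_apply, ← inner_single_blockOperator_single, hS,
    mul_apply_eq_comp, ContinuousLinearMap.star_eq_adjoint,
    ContinuousLinearMap.adjoint_inner_right, PiLp.inner_apply]
  rfl

lemma mem_matPos_iff_forall_sum_inner_nonneg {M : Matrix (Fin n) (Fin n) (H →L[ℂ] H)} :
    M ∈ matPos (H →L[ℂ] H) n ↔ ∀ ξ : Fin n → H, 0 ≤ ∑ i, ∑ j, ⟪ξ i, M i j (ξ j)⟫_ℂ := by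
  constructor
  · rintro ⟨B, rfl⟩ ξ
    have hsq : ∑ i, ∑ j, ⟪ξ i, (B.conjTranspose * B) i j (ξ j)⟫_ℂ
        = ∑ k, ⟪∑ i, B k i (ξ i), ∑ j, B k j (ξ j)⟫_ℂ := by
      simp only [inner_conjTranspose_mul_self_apply, inner_sum, sum_inner]
      rw [Finset.sum_comm_cycle]
      exact Finset.sum_congr rfl fun k _ => Finset.sum_comm
    rw [hsq]
    exact Finset.sum_nonneg fun k _ => ContinuousLinearMap.isPositive_one.inner_nonneg_right _
  · intro h
    refine mem_matPos_of_isPositive_blockOperator (isPositive_iff_forall_inner_nonneg.2 fun η => ?_)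
    rw [inner_blockOperator]
    exact h fun i => η i

variable {K : Type*} [NormedAddCommGroup K] [InnerProductSpace ℂ K] [CompleteSpace K]

/-- The compression `T ↦ W* T W` along a bounded operator `W`. -/
def compression (W : H →L[ℂ] K) : (K →L[ℂ] K) →ₗ[ℂ] (H →L[ℂ] H) where
  toFun T := ContinuousLinearMap.adjoint W ∘L T ∘L W
  map_add' S T := by simp
  map_smul' c T := by simp

lemma inner_compression (W : H →L[ℂ] K) (T : K →L[ℂ] K) (ξ η : H) :
    ⟪ξ, compression W T η⟫_ℂ = ⟪W ξ, T (W η)⟫_ℂ :=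
  ContinuousLinearMap.adjoint_inner_right W ξ (T (W η))

lemma compression_one (W : H →ₗᵢ[ℂ] K) : compression W.toContinuousLinearMap 1 = 1 :=
  W.adjoint_comp_self

lemma isCP_compression (W : H →L[ℂ] K) :
    IsCP (matPos (K →L[ℂ] K)) (matPos (H →L[ℂ] H)) (compression W) := by
  intro n M hM
  rw [mem_matPos_iff_forall_sum_inner_nonneg] at hM ⊢
  intro ξ
  simpa only [Matrix.map_apply, inner_compression] using hM fun i => W (ξ i)

end Operators

/-! ### Finitely supported operator kernels -/

section Kernels

variable {ι A : Type*}

section StarAlgebra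

variable [Ring A] [StarRing A] [Algebra ℂ A] [StarModule ℂ A]

/-- The kernel `(i, j) ↦ x(i)* y(j)` on `ι`, as a sesquilinear function of `x` and `y`. -/
def starMulKernel : (ι →₀ A) →ₗ⋆[ℂ] (ι →₀ A) →ₗ[ℂ] (ι × ι →₀ A) :=
  LinearMap.mk₂'ₛₗ (starRingEnd ℂ) (RingHom.id ℂ)
    (fun x y => Finsupp.onFinset (x.support ×ˢ y.support) (fun p => star (x p.1) * y p.2)
      fun p hp => by
        rw [Finset.mem_product, Finsupp.mem_support_iff, Finsupp.mem_support_iff]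
        exact ⟨fun h => hp (by simp [h]), fun h => hp (by simp [h])⟩)
    (fun x y z => by ext p; simp [add_mul])
    (fun c x y => by ext p; simp)
    (fun x y z => by ext p; simp [mul_add])
    (fun c x y => by ext p; simp)

@[simp]
lemma starMulKernel_apply (x y : ι →₀ A) (p : ι × ι) :
    starMulKernel x y p = star (x p.1) * y p.2 := rfl

lemma starMulKernel_single (i j : ι) (a b : A) :
    starMulKernel (Finsupp.single i a) (Finsupp.single j b) =
      Finsupp.single (i, j) (star a * b) := by
  classical
  ext ⟨k, l⟩
  by_cases hk : i = k <;> by_cases hl : j = l <;> simp [hk, hl]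

/-- The adjoint `(i, j) ↦ M(j, i)*` of a kernel `M`, as a conjugate-linear map. -/
def kernelStar : (ι × ι →₀ A) →ₗ⋆[ℂ] (ι × ι →₀ A) where
  toFun M := Finsupp.equivMapDomain (Equiv.prodComm ι ι) (M.mapRange star (star_zero A))
  map_add' M N := by ext p; simp
  map_smul' c M := by ext p; simp

@[simp]
lemma kernelStar_apply (M : ι × ι →₀ A) (p : ι × ι) : kernelStar M p = star (M p.swap) := rfl

lemma kernelStar_kernelStar (M : ι × ι →₀ A) : kernelStar (kernelStar M) = M := by
  ext p; simp

lemma kernelStar_starMulKernel (x y : ι →₀ A) :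
    kernelStar (starMulKernel x y) = starMulKernel y x := by
  ext p; simp

lemma kernelStar_single (i j : ι) (a : A) :
    kernelStar (Finsupp.single (i, j) a) = Finsupp.single (j, i) (star a) := by
  simpa [starMulKernel_single] using
    kernelStar_starMulKernel (Finsupp.single i 1) (Finsupp.single j a)

end StarAlgebra

variable [CStarAlgebra A]

/-- The cone of positive semidefinite kernels: all matrices `(M (vᵢ, vⱼ))ᵢⱼ` are positive. -/
def psdKernelCone (ι A : Type*) [CStarAlgebra A] : PointedCone ℝ (ι × ι →₀ A) where
  carrier := {M | ∀ (n : ℕ) (v : Fin n → ι), Matrix.of (fun i j => M (v i, v j)) ∈ matPos A n}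
  add_mem' hM hN n v := add_mem_matPos (hM n v) (hN n v)
  zero_mem' _ _ := zero_mem_matPos
  smul_mem' c M hM n v := by
    convert smul_mem_matPos c.2 (hM n v) using 1
    ext i j
    simp

lemma starMulKernel_self_mem_psdKernelCone (x : ι →₀ A) :
    starMulKernel x x ∈ psdKernelCone ι A :=
  fun _ v => star_mul_mem_matPos fun i => x (v i)

/-- The cone of kernels with positive semidefinite hermitian part. Unlike `psdKernelCone`, it is
absorbed by the kernels with scalar diagonal values, as the Riesz extension theorem demands. -/
def posKernelCone (ι A : Type*) [CStarAlgebra A] : PointedCone ℝ (ι × ι →₀ A) where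
  carrier := {M | M + kernelStar M ∈ psdKernelCone ι A}
  add_mem' {M N} hM hN := by
    rw [Set.mem_ofPred_eq, map_add, add_add_add_comm]
    exact add_mem hM hN
  zero_mem' := by
    rw [Set.mem_ofPred_eq, map_zero, add_zero]
    exact zero_mem _
  smul_mem' c M hM := by
    have hc : kernelStar (c • M) = c • kernelStar M := by
      ext p
      exact star_smul (c : ℝ) (M p.swap)
    rw [Set.mem_ofPred_eq, hc, ← smul_add]
    exact Submodule.smul_mem _ c hM

lemma mem_posKernelCone {M : ι × ι →₀ A} :
    M ∈ posKernelCone ι A ↔ M + kernelStar M ∈ psdKernelCone ι A := Iff.rfl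

lemma starMulKernel_self_mem_posKernelCone (x : ι →₀ A) :
    starMulKernel x x ∈ posKernelCone ι A := by
  rw [mem_posKernelCone, kernelStar_starMulKernel]
  exact add_mem (starMulKernel_self_mem_psdKernelCone x) (starMulKernel_self_mem_psdKernelCone x)

lemma sub_kernelStar_mem_posKernelCone (M : ι × ι →₀ A) :
    M - kernelStar M ∈ posKernelCone ι A := by
  rw [mem_posKernelCone, map_sub, kernelStar_kernelStar, sub_add_sub_cancel, sub_self]
  exact zero_mem _

-- With `b* b = ‖a‖² - a* a`, the hermitian part is half of
-- `(δᵢ + a δⱼ)* (δᵢ + a δⱼ) + (b δⱼ)* (b δⱼ)`.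
lemma add_single_mem_posKernelCone (i j : ι) (a : A) :
    ((1 / 2 : ℝ) : ℂ) • Finsupp.single (i, i) 1 +
      ((‖a‖ ^ 2 / 2 : ℝ) : ℂ) • Finsupp.single (j, j) 1 + Finsupp.single (i, j) a ∈
        posKernelCone ι A := by
  obtain ⟨b, hb⟩ := exists_norm_sq_smul_one_sub_eq_star_mul_self a
  have hdiag (r : ℝ) (k : ι) : ((r / 2 : ℝ) : ℂ) • Finsupp.single (k, k) (1 : A) +
      kernelStar (((r / 2 : ℝ) : ℂ) • Finsupp.single (k, k) (1 : A)) =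
        Finsupp.single (k, k) ((r : ℂ) • (1 : A)) := by
    rw [map_smulₛₗ, kernelStar_single, star_one, Complex.conj_ofReal, ← add_smul,
      ← Complex.ofReal_add, add_halves, Finsupp.smul_single]
  have hi := hdiag 1 i
  have hj := hdiag (‖a‖ ^ 2) j
  rw [Complex.ofReal_one, one_smul] at hi
  rw [sub_eq_iff_eq_add.1 hb, Finsupp.single_add] at hj
  rw [mem_posKernelCone]
  convert add_mem
    (starMulKernel_self_mem_psdKernelCone (Finsupp.single i 1 + Finsupp.single j a))
    (starMulKernel_self_mem_psdKernelCone (Finsupp.single j b)) using 1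
  simp only [map_add, LinearMap.add_apply, starMulKernel_single, star_one, one_mul, mul_one,
    kernelStar_single (a := a)]
  linear_combination (norm := abel) hi + hj

lemma exists_add_mem_posKernelCone {T : Submodule ℂ A} (hone : (1 : A) ∈ T)
    (M : ι × ι →₀ A) :
    ∃ D ∈ Finsupp.submodule fun _ : ι × ι => T, D + M ∈ posKernelCone ι A := by
  induction M using Finsupp.induction_linear with
  | zero => exact ⟨0, zero_mem _, by simp⟩
  | add M N hM hN =>
    obtain ⟨D, hD, hDM⟩ := hM
    obtain ⟨D', hD', hDN⟩ := hN
    refine ⟨D + D', add_mem hD hD', ?_⟩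
    rw [add_add_add_comm]
    exact add_mem hDM hDN
  | single p a =>
    have hone_mem (k : ι) :
        Finsupp.single (k, k) (1 : A) ∈ Finsupp.submodule fun _ : ι × ι => T :=
      (Finsupp.comap_lsingle_submodule (fun _ => T) (k, k)).ge hone
    exact ⟨_, add_mem (Submodule.smul_mem _ _ (hone_mem p.1))
      (Submodule.smul_mem _ _ (hone_mem p.2)), add_single_mem_posKernelCone p.1 p.2 a⟩

end Kernels

/-! ### Extension of completely positive maps to positive kernel functionals -/

section ComplexRiesz

variable {E : Type*} [AddCommGroup E] [Module ℂ E]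

lemma map_eq_conj_of_re_map_eq {σ : E →ₗ⋆[ℂ] E} {g : E →ₗ[ℂ] ℂ}
    (h : ∀ x, (g (σ x)).re = (g x).re) (x : E) : g (σ x) = starRingEnd ℂ (g x) := by
  have him : (g (σ x)).im = -(g x).im := by simpa using h (Complex.I • x)
  exact Complex.ext (h x) him

variable [Module ℝ E] [IsScalarTower ℝ ℂ E]

lemma exists_extension_re_nonneg (s : PointedCone ℝ E) (D : Submodule ℂ E) (f : E →ₗ[ℂ] ℂ)
    (hf : ∀ x ∈ D, x ∈ s → 0 ≤ (f x).re) (hD : ∀ y, ∃ x ∈ D, x + y ∈ s) :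
    ∃ g : E →ₗ[ℂ] ℂ, (∀ x ∈ D, g x = f x) ∧ ∀ x ∈ s, 0 ≤ (g x).re := by
  let reD : E →ₗ.[ℝ] ℝ :=
    { domain := D.restrictScalars ℝ
      toFun := (Complex.reLm ∘ₗ f.restrictScalars ℝ).domRestrict _ }
  obtain ⟨g, hgf, hg⟩ := riesz_extension s reD (fun x hx => hf x x.2 hx) (fun y => by
    obtain ⟨x, hx, hxy⟩ := hD y
    exact ⟨⟨x, hx⟩, hxy⟩)
  have hgD (x : E) (hx : x ∈ D) : g x = (f x).re := hgf ⟨x, hx⟩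
  refine ⟨Module.Dual.extendRCLike g, fun x hx => ?_, fun x hx => ?_⟩
  · rw [Module.Dual.extendRCLike_apply, hgD x hx, hgD _ (D.smul_mem _ hx), map_smul]
    exact Complex.ext (by simp) (by simp)
  · exact (hg x hx).trans_eq (Module.Dual.re_extendRCLike_apply (𝕜 := ℂ) g x).symm

end ComplexRiesz

/-- A positive functional on the finitely supported kernels with values in `A`. -/
structure PosKernelFunctional (ι A : Type*) [CStarAlgebra A] where
  toLin : (ι × ι →₀ A) →ₗ[ℂ] ℂ
  re_nonneg : ∀ x : ι →₀ A, 0 ≤ (toLin (starMulKernel x x)).re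
  map_kernelStar : ∀ M, toLin (kernelStar M) = starRingEnd ℂ (toLin M)

section KernelFunctional

variable {A : Type*} [AddCommGroup A] [Module ℂ A]
  {H : Type*} [NormedAddCommGroup H] [InnerProductSpace ℂ H]

/-- The functional `M ↦ ∑ ⟪ξ, φ(M(ξ, η)) η⟫` on kernels over `H` induced by `φ : A → B(H)`. -/
def kernelFunctional (φ : A →ₗ[ℂ] (H →L[ℂ] H)) : (H × H →₀ A) →ₗ[ℂ] ℂ :=
  Finsupp.lsum ℂ fun p : H × H =>
    (innerSL ℂ p.1).toLinearMap ∘ₗ (ContinuousLinearMap.apply ℂ H p.2).toLinearMap ∘ₗ φ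

lemma kernelFunctional_apply (φ : A →ₗ[ℂ] (H →L[ℂ] H)) (M : H × H →₀ A) :
    kernelFunctional φ M = M.sum fun p a => ⟪p.1, φ a p.2⟫_ℂ := rfl

lemma kernelFunctional_single (φ : A →ₗ[ℂ] (H →L[ℂ] H)) (ξ η : H) (a : A) :
    kernelFunctional φ (Finsupp.single (ξ, η) a) = ⟪ξ, φ a η⟫_ℂ := by
  rw [kernelFunctional_apply, Finsupp.sum_single_index]
  simp

variable [CompleteSpace H]

open scoped ComplexOrder in
lemma kernelFunctional_nonneg (φ : A →ₗ[ℂ] (H →L[ℂ] H)) (M : H × H →₀ A)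
    (hM : ∀ (n : ℕ) (v : Fin n → H),
      Matrix.of (fun i j => φ (M (v i, v j))) ∈ matPos (H →L[ℂ] H) n) :
    0 ≤ kernelFunctional φ M := by
  classical
  let s : Finset H := M.support.image Prod.fst ∪ M.support.image Prod.snd
  have hs : M.support ⊆ s ×ˢ s := fun p hp => Finset.mem_product.2
    ⟨Finset.mem_union_left _ (Finset.mem_image_of_mem _ hp),
      Finset.mem_union_right _ (Finset.mem_image_of_mem _ hp)⟩
  have hsum : kernelFunctional φ M = ∑ ξ ∈ s, ∑ η ∈ s, ⟪ξ, φ (M (ξ, η)) η⟫_ℂ := by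
    rw [kernelFunctional_apply, Finsupp.sum_of_support_subset _ hs _ (by simp),
      Finset.sum_product]
  let v : Fin s.card → H := fun i => s.equivFin.symm i
  have hreindex (F : H → ℂ) : ∑ ξ ∈ s, F ξ = ∑ i, F (v i) := by
    rw [← Finset.sum_coe_sort s F]
    exact (Equiv.sum_comp s.equivFin.symm fun i : s => F i).symm
  simp only [hsum, hreindex]
  exact mem_matPos_iff_forall_sum_inner_nonneg.1 (hM _ v) v

lemma kernelFunctional_kernelStar {A : Type*} [Ring A] [StarRing A] [Algebra ℂ A]
    [StarModule ℂ A] (φ : A →ₗ[ℂ] (H →L[ℂ] H)) {M : H × H →₀ A}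
    (hM : ∀ p, φ (star (M p)) = star (φ (M p))) :
    kernelFunctional φ (kernelStar M) = starRingEnd ℂ (kernelFunctional φ M) := by
  have hswap : kernelFunctional φ (kernelStar M) =
      (M.mapRange star (star_zero A)).sum fun p a => ⟪p.2, φ a p.1⟫_ℂ := by
    change kernelFunctional φ (Finsupp.equivMapDomain _ _) = _
    rw [kernelFunctional_apply, Finsupp.equivMapDomain_eq_mapDomain,
      Finsupp.sum_mapDomain_index (by simp) (by simp)]
    rfl
  rw [hswap, Finsupp.sum_mapRange_index (by simp), kernelFunctional_apply, Finsupp.sum,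
    Finsupp.sum, map_sum]
  refine Finset.sum_congr rfl fun p _ => ?_
  rw [hM p, ContinuousLinearMap.star_eq_adjoint, ContinuousLinearMap.adjoint_inner_right,
    inner_conj_symm]

end KernelFunctional

section Extension

/-- The matricial cones that a subspace `T` of a C*-algebra inherits from it. -/
def inheritedCone {A : Type*} [Ring A] [StarRing A] [Algebra ℂ A] (T : Submodule ℂ A) (n : ℕ) :
    Set (Matrix (Fin n) (Fin n) T) :=
  {M | M.map Subtype.val ∈ matPos A n}

variable {A : Type*} [CStarAlgebra A] {T : Submodule ℂ A}

lemma isCP_subtype (T : Submodule ℂ A) : IsCP (inheritedCone T) (matPos A) T.subtype :=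
  fun _ _ hM => hM

lemma of_fin_two_mem_matPos (a : A) :
    !![1, a; star a, ((‖a‖ ^ 2 : ℝ) : ℂ) • 1] ∈ matPos A 2 := by
  obtain ⟨b, hb⟩ := exists_norm_sq_smul_one_sub_eq_star_mul_self a
  convert add_mem_matPos (star_mul_mem_matPos ![1, a]) (star_mul_mem_matPos ![0, b]) using 1
  ext i j
  fin_cases i <;> fin_cases j <;> simp [← hb]

variable {H : Type*} [NormedAddCommGroup H] [InnerProductSpace ℂ H] [CompleteSpace H]
  {φ : A →ₗ[ℂ] (H →L[ℂ] H)}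

lemma IsCP.map_mem_matPos {n : ℕ} {M : Matrix (Fin n) (Fin n) A}
    (hφ : IsCP (inheritedCone T) (matPos (H →L[ℂ] H)) (φ ∘ₗ T.subtype)) (hMT : ∀ i j, M i j ∈ T)
    (hM : M ∈ matPos A n) : M.map φ ∈ matPos (H →L[ℂ] H) n :=
  hφ n (Matrix.of fun i j => ⟨M i j, hMT i j⟩) hM

lemma IsCP.map_star (hφ : IsCP (inheritedCone T) (matPos (H →L[ℂ] H)) (φ ∘ₗ T.subtype))
    (hone : 1 ∈ T) (hstar : ∀ t ∈ T, star t ∈ T) {t : A} (ht : t ∈ T) :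
    φ (star t) = star (φ t) := by
  have hmem := hφ.map_mem_matPos (fun i j => by
    fin_cases i <;> fin_cases j
    exacts [hone, ht, hstar t ht, T.smul_mem _ hone]) (of_fin_two_mem_matPos t)
  exact (congrFun₂ (conjTranspose_eq_of_mem_matPos hmem) 1 0).symm

lemma IsCP.re_kernelFunctional_nonneg
    (hφ : IsCP (inheritedCone T) (matPos (H →L[ℂ] H)) (φ ∘ₗ T.subtype))
    (hone : 1 ∈ T) (hstar : ∀ t ∈ T, star t ∈ T) {M : H × H →₀ A} (hMT : ∀ p, M p ∈ T)
    (hM : M ∈ posKernelCone H A) : 0 ≤ (kernelFunctional φ M).re := by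
  have hnonneg := kernelFunctional_nonneg φ (M + kernelStar M) fun n v =>
    hφ.map_mem_matPos (fun i j => T.add_mem (hMT _) (hstar _ (hMT _))) (hM n v)
  rw [map_add, kernelFunctional_kernelStar φ fun p => hφ.map_star hone hstar (hMT p)] at hnonneg
  have hre := (Complex.nonneg_iff.1 hnonneg).1
  rw [Complex.add_re, Complex.conj_re] at hre
  linarith

theorem IsCP.exists_posKernelFunctional
    (hφ : IsCP (inheritedCone T) (matPos (H →L[ℂ] H)) (φ ∘ₗ T.subtype))
    (hone : 1 ∈ T) (hstar : ∀ t ∈ T, star t ∈ T) :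
    ∃ g : PosKernelFunctional H A, ∀ t ∈ T, ∀ ξ η : H,
      g.toLin (Finsupp.single (ξ, η) t) = ⟪ξ, φ t η⟫_ℂ := by
  obtain ⟨g, hgφ, hg⟩ := exists_extension_re_nonneg (posKernelCone H A)
    (Finsupp.submodule fun _ => T) (kernelFunctional φ)
    (fun M hMT hM => hφ.re_kernelFunctional_nonneg hone hstar hMT hM)
    (exists_add_mem_posKernelCone hone)
  have hre (M : H × H →₀ A) : (g (kernelStar M)).re = (g M).re := by
    have hM := hg _ (sub_kernelStar_mem_posKernelCone M)
    have hM' := hg _ (sub_kernelStar_mem_posKernelCone (kernelStar M))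
    rw [map_sub, Complex.sub_re] at hM hM'
    rw [kernelStar_kernelStar] at hM'
    linarith
  refine ⟨⟨g, fun x => hg _ (starMulKernel_self_mem_posKernelCone x),
    map_eq_conj_of_re_map_eq hre⟩, fun t ht ξ η => ?_⟩
  rw [← kernelFunctional_single]
  exact hgφ _ ((Finsupp.comap_lsingle_submodule (fun _ => T) (ξ, η)).ge ht)

end Extension

/-! ### The Stinespring dilation -/

namespace PosKernelFunctional

variable {ι A : Type*} [CStarAlgebra A] (g : PosKernelFunctional ι A)

/-- The finitely supported functions `ι → A`, to carry the semi-inner product of `g`. -/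
def PreSpace (_g : PosKernelFunctional ι A) : Type _ := ι →₀ A

instance : AddCommGroup g.PreSpace := inferInstanceAs (AddCommGroup (ι →₀ A))
instance : Module ℂ g.PreSpace := inferInstanceAs (Module ℂ (ι →₀ A))
instance : Module A g.PreSpace := inferInstanceAs (Module A (ι →₀ A))
instance : IsScalarTower ℂ A g.PreSpace := inferInstanceAs (IsScalarTower ℂ A (ι →₀ A))

/-- The finitely supported function underlying an element of `PreSpace`. -/
def toFinsupp : g.PreSpace ≃ₗ[A] (ι →₀ A) := LinearEquiv.refl A _

/-- The semi-inner product `⟪x, y⟫ = g(x* y)`. -/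
abbrev preCore : PreInnerProductSpace.Core ℂ g.PreSpace where
  inner x y := g.toLin (starMulKernel (g.toFinsupp x) (g.toFinsupp y))
  conj_inner_symm x y := by rw [← g.map_kernelStar, kernelStar_starMulKernel]
  re_inner_nonneg x := g.re_nonneg _
  add_left x y z := by rw [map_add, map_add, LinearMap.add_apply, map_add]
  smul_left x y c := by
    have hc : g.toFinsupp (c • x) = c • g.toFinsupp x := rfl
    rw [hc, map_smulₛₗ, LinearMap.smul_apply, map_smul, smul_eq_mul]

instance : SeminormedAddCommGroup g.PreSpace :=
  InnerProductSpace.Core.toSeminormedAddCommGroup (c := g.preCore)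
instance : InnerProductSpace ℂ g.PreSpace := InnerProductSpace.ofCore g.preCore

lemma inner_def (x y : g.PreSpace) :
    ⟪x, y⟫_ℂ = g.toLin (starMulKernel (g.toFinsupp x) (g.toFinsupp y)) := rfl

lemma inner_smul_left_eq_inner_star_smul_right (a : A) (x y : g.PreSpace) :
    ⟪a • x, y⟫_ℂ = ⟪x, star a • y⟫_ℂ := by
  rw [inner_def, inner_def, g.toFinsupp.map_smul, g.toFinsupp.map_smul]
  congr 1
  ext p
  simp [mul_assoc]

lemma norm_smul_le_norm_mul_norm (a : A) (x : g.PreSpace) : ‖a • x‖ ≤ ‖a‖ * ‖x‖ := by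
  obtain ⟨b, hb⟩ := exists_norm_sq_smul_one_sub_eq_star_mul_self a
  have hinner (c : A) : ((‖c • x‖ ^ 2 : ℝ) : ℂ) = ⟪x, (star c * c) • x⟫_ℂ := by
    rw [mul_smul, ← inner_smul_left_eq_inner_star_smul_right, inner_self_eq_norm_sq_to_K]
    norm_cast
  have hsq : ‖b • x‖ ^ 2 = (‖a‖ * ‖x‖) ^ 2 - ‖a • x‖ ^ 2 := by
    have h : ((‖b • x‖ ^ 2 : ℝ) : ℂ) =
        ((‖a‖ ^ 2 : ℝ) : ℂ) * ((‖x‖ ^ 2 : ℝ) : ℂ) - ((‖a • x‖ ^ 2 : ℝ) : ℂ) := by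
      rw [hinner b, hinner a, ← hb, sub_smul, inner_sub_right, smul_assoc, one_smul,
        inner_smul_right, inner_self_eq_norm_sq_to_K, Complex.ofReal_pow ‖x‖]
      rfl
    rw [mul_pow]
    exact_mod_cast h
  exact (sq_le_sq₀ (norm_nonneg _) (by positivity)).1 (by linarith [sq_nonneg ‖b • x‖])

/-- The Hilbert space of `g`. -/
abbrev Space : Type _ := UniformSpace.Completion g.PreSpace

/-- The action of `a : A` on the Hilbert space of `g`, extending `x ↦ a • x`. -/
def repOperator (a : A) : g.Space →L[ℂ] g.Space :=
  ((Algebra.lsmul ℂ ℂ g.PreSpace a).mkContinuous ‖a‖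
    (g.norm_smul_le_norm_mul_norm a)).completion

lemma repOperator_coe (a : A) (x : g.PreSpace) :
    g.repOperator a (x : g.Space) = ((a • x : g.PreSpace) : g.Space) :=
  ContinuousLinearMap.completion_apply_coe _ _

variable {g} in
lemma operator_ext {S T : g.Space →L[ℂ] g.Space} (h : ∀ x : g.PreSpace, S x = T x) : S = T :=
  ContinuousLinearMap.ext fun x => UniformSpace.Completion.induction_on x
    (isClosed_eq S.continuous T.continuous) h

lemma repOperator_star (a : A) : g.repOperator (star a) = star (g.repOperator a) := by
  rw [ContinuousLinearMap.star_eq_adjoint, ContinuousLinearMap.eq_adjoint_iff]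
  intro x y
  induction x, y using UniformSpace.Completion.induction_on₂ with
  | hp => apply isClosed_eq <;> fun_prop
  | ih x y =>
    rw [repOperator_coe, repOperator_coe, UniformSpace.Completion.inner_coe,
      UniformSpace.Completion.inner_coe, inner_smul_left_eq_inner_star_smul_right, star_star]

/-- The Gelfand–Naimark–Segal representation of `A` on the Hilbert space of `g`. -/
def rep : A →⋆ₐ[ℂ] (g.Space →L[ℂ] g.Space) where
  toFun := g.repOperator
  map_one' := operator_ext fun x => by rw [repOperator_coe, one_smul, one_apply_eq_self]
  map_mul' a b := operator_ext fun x => by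
    rw [mul_apply_eq_comp, repOperator_coe, repOperator_coe, repOperator_coe, mul_smul]
  map_zero' := operator_ext fun x => by
    rw [repOperator_coe, zero_smul, UniformSpace.Completion.coe_zero, zero_apply]
  map_add' a b := operator_ext fun x => by
    rw [add_apply, repOperator_coe, repOperator_coe, repOperator_coe, add_smul,
      UniformSpace.Completion.coe_add]
  commutes' c := operator_ext fun x => by
    rw [repOperator_coe, algebraMap_smul, UniformSpace.Completion.coe_smul]
    rfl
  map_star' := g.repOperator_star

/-- The vector `δᵢ` of the Hilbert space of `g`. -/
def vec (i : ι) : g.Space := (g.toFinsupp.symm (Finsupp.single i 1) : g.PreSpace)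

lemma inner_vec_rep_vec (i j : ι) (a : A) :
    ⟪g.vec i, g.rep a (g.vec j)⟫_ℂ = g.toLin (Finsupp.single (i, j) a) := by
  change ⟪g.vec i, g.repOperator a _⟫_ℂ = _
  rw [vec, vec, repOperator_coe, UniformSpace.Completion.inner_coe, inner_def, map_smul,
    LinearEquiv.apply_symm_apply, LinearEquiv.apply_symm_apply, Finsupp.smul_single,
    smul_eq_mul, mul_one, starMulKernel_single, star_one, one_mul]

lemma inner_vec_vec (i j : ι) : ⟪g.vec i, g.vec j⟫_ℂ = g.toLin (Finsupp.single (i, j) 1) := by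
  rw [← inner_vec_rep_vec, map_one, one_apply_eq_self]

end PosKernelFunctional

/-- An inner-product preserving map between complex inner product spaces, as a linear isometry:
linearity is automatic. -/
def isometryOfInner {H K : Type*} [NormedAddCommGroup H] [InnerProductSpace ℂ H]
    [NormedAddCommGroup K] [InnerProductSpace ℂ K] (f : H → K)
    (hf : ∀ ξ η, ⟪f ξ, f η⟫_ℂ = ⟪ξ, η⟫_ℂ) : H →ₗᵢ[ℂ] K :=
  LinearMap.isometryOfInner
    { toFun := f
      map_add' := fun ξ η => by
        rw [← sub_eq_zero, ← inner_self_eq_zero (𝕜 := ℂ)]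
        simp only [inner_sub_left, inner_sub_right, inner_add_left, inner_add_right, hf]
        ring
      map_smul' := fun c ξ => by
        rw [← sub_eq_zero, ← inner_self_eq_zero (𝕜 := ℂ)]
        simp only [inner_sub_left, inner_sub_right, inner_smul_left, inner_smul_right, hf,
          RingHom.id_apply]
        ring }
    hf

theorem IsCP.exists_stinespring {A H : Type u} [CStarAlgebra A] [NormedAddCommGroup H]
    [InnerProductSpace ℂ H] [CompleteSpace H] {T : Submodule ℂ A} (hone : 1 ∈ T)
    (hstar : ∀ t ∈ T, star t ∈ T) {φ : T →ₗ[ℂ] (H →L[ℂ] H)}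
    (hφ : IsCP (inheritedCone T) (matPos (H →L[ℂ] H)) φ) (hφone : φ ⟨1, hone⟩ = 1) :
    ∃ (K : Type u) (_ : NormedAddCommGroup K) (_ : InnerProductSpace ℂ K) (_ : CompleteSpace K)
      (π : A →⋆ₐ[ℂ] (K →L[ℂ] K)) (W : H →ₗᵢ[ℂ] K),
      ∀ t : T, φ t = compression W.toContinuousLinearMap (π t) := by
  obtain ⟨ψ, rfl⟩ := φ.exists_extend
  obtain ⟨g, hg⟩ := hφ.exists_posKernelFunctional hone hstar
  have hψone : ψ 1 = 1 := hφone
  let W : H →ₗᵢ[ℂ] g.Space := isometryOfInner g.vec fun ξ η => by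
    rw [g.inner_vec_vec, hg 1 hone, hψone, one_apply_eq_self]
  refine ⟨g.Space, inferInstance, inferInstance, inferInstance, g.rep, W, fun t => ?_⟩
  refine ContinuousLinearMap.ext fun η => ext_inner_left ℂ fun ξ => ?_
  rw [inner_compression]
  exact (hg t t.2 ξ η).symm.trans (g.inner_vec_rep_vec ξ η t).symm

/-! ### Dilatable representations and completely positive maps on `T_G` -/

section Representation

variable {V : Type u} [Fintype V] {G : ContextualityScenario V}

lemma star_mem_TSys {t : G.CStar} (ht : t ∈ G.TSys) : star t ∈ G.TSys := by
  induction ht using Submodule.span_induction with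
  | mem t ht =>
    obtain ⟨x, rfl⟩ := ht
    rw [(G.isStarProjection_projGen x).isSelfAdjoint.star_eq]
    exact (G.tGen x).2
  | zero => rw [star_zero]; exact zero_mem _
  | add s t _ _ hs ht => rw [star_add]; exact add_mem hs ht
  | smul c t _ ht => rw [star_smul]; exact Submodule.smul_mem _ _ ht

lemma span_range_tGen : Submodule.span ℂ (Set.range G.tGen) = ⊤ := by
  have hpre : Set.range G.tGen = Subtype.val ⁻¹' Set.range G.projGen :=
    Set.ext fun t => exists_congr fun x => Subtype.ext_iff
  rw [hpre]
  exact Submodule.span_span_coe_preimage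

lemma TSys_hom_ext {E : Type*} [AddCommGroup E] [Module ℂ E] {φ ψ : G.TSys →ₗ[ℂ] E}
    (h : ∀ x, φ (G.tGen x) = ψ (G.tGen x)) : φ = ψ :=
  LinearMap.ext_on_range span_range_tGen h

section Compression

variable {H K : Type*} [NormedAddCommGroup H] [InnerProductSpace ℂ H] [CompleteSpace H]
  [NormedAddCommGroup K] [InnerProductSpace ℂ K] [CompleteSpace K]

lemma IsPOR.of_isDilation {A : V → H →L[ℂ] H} {B : V → K →L[ℂ] K} (hB : G.IsPOR B)
    (hAB : IsDilation A B) : G.IsPOR A := by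
  obtain ⟨W, hW⟩ := hAB
  refine ⟨fun x => (hW x) ▸ (hB.pos x).adjoint_conj _, fun e he => ?_⟩
  have hA (x : V) : A x = compression W.toContinuousLinearMap (B x) := hW x
  simp only [hA]
  rw [← map_sum, hB.sum_eq e he, compression_one]

lemma isPR_map_projGen (π : G.CStar →⋆ₐ[ℂ] (K →L[ℂ] K)) : G.IsPR fun x => π (G.projGen x) where
  pos x := ContinuousLinearMap.nonneg_iff_isPositive _ |>.1
    ((G.isStarProjection_projGen x).map π).nonneg
  sum_eq e he := by rw [← map_sum, G.sum_projGen he, map_one]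
  proj x := (G.isStarProjection_projGen x).map π

end Compression

variable {H : Type u} [NormedAddCommGroup H] [InnerProductSpace ℂ H] [CompleteSpace H]

section Lift

variable {P : V → H →L[ℂ] H}

lemma IsPR.continuous_eval (hP : G.IsPR P) : Continuous (G.eval P) :=
  AddMonoidHomClass.continuous_of_bound (G.eval P) 1 fun a => by
    rw [one_mul]
    exact hP.norm_eval_le a

variable (hP : G.IsPR P)

/-- The ring homomorphism `C*(G) → B(H)` extending the evaluation at a PR by continuity. -/
def IsPR.evalExtension : G.CStar →+* (H →L[ℂ] H) :=
  UniformSpace.Completion.extensionHom (G.eval P).toRingHom hP.continuous_eval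

lemma IsPR.evalExtension_toCStar (a : G.PreAlg) :
    hP.evalExtension (G.toCStar a) = G.eval P a :=
  UniformSpace.Completion.extensionHom_coe _ hP.continuous_eval a

lemma IsPR.evalExtension_star (a : G.CStar) :
    hP.evalExtension (star a) = star (hP.evalExtension a) := by
  have hcont : Continuous hP.evalExtension := UniformSpace.Completion.continuous_extension
  refine G.denseRange_toCStar.induction_on
    (p := fun a => hP.evalExtension (star a) = star (hP.evalExtension a)) a
    (isClosed_eq (hcont.comp G.continuous_star_cstar) (continuous_star.comp hcont)) fun a => ?_
  rw [star_toCStar, hP.evalExtension_toCStar, hP.evalExtension_toCStar, hP.eval_star]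

/-- The *-representation of `C*(G)` given by a PR through the universal property. -/
def IsPR.lift : G.CStar →⋆ₐ[ℂ] (H →L[ℂ] H) where
  __ := hP.evalExtension
  commutes' c := by
    change hP.evalExtension _ = _
    rw [← G.toCStar.commutes, hP.evalExtension_toCStar, AlgHom.commutes]
  map_star' := hP.evalExtension_star

lemma IsPR.lift_projGen (x : V) : hP.lift (G.projGen x) = P x :=
  (hP.evalExtension_toCStar _).trans (G.eval_gen P x)

end Lift

theorem IsUCP.isDilatablePOR {φ : G.TSys →ₗ[ℂ] (H →L[ℂ] H)} (hφ : G.IsUCP φ) :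
    G.IsDilatablePOR fun x => φ (G.tGen x) := by
  obtain ⟨K, _, _, _, π, W, hπ⟩ :=
    IsCP.exists_stinespring G.one_mem_TSys (fun _ => star_mem_TSys) hφ.2 hφ.1
  have hPR := isPR_map_projGen π
  have hdil : IsDilation (fun x => φ (G.tGen x)) fun x => π (G.projGen x) :=
    ⟨W, fun x => hπ (G.tGen x)⟩
  exact ⟨hPR.toIsPOR.of_isDilation hdil, K, inferInstance, inferInstance, inferInstance, _, hPR,
    hdil⟩

theorem IsDilatablePOR.exists_isUCP {A : V → H →L[ℂ] H} (hA : G.IsDilatablePOR A) :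
    ∃ φ : G.TSys →ₗ[ℂ] (H →L[ℂ] H), G.IsUCP φ ∧ ∀ x, φ (G.tGen x) = A x := by
  obtain ⟨-, K, _, _, _, P, hP, W, hW⟩ := hA
  let φ : G.TSys →ₗ[ℂ] (H →L[ℂ] H) := compression W.toContinuousLinearMap ∘ₗ
    (hP.lift : G.CStar →ₐ[ℂ] (K →L[ℂ] K)).toLinearMap ∘ₗ G.TSys.subtype
  have hφ (t : G.TSys) : φ t = compression W.toContinuousLinearMap (hP.lift t) := rfl
  refine ⟨φ, ⟨?_, ?_⟩, fun x => ?_⟩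
  · rw [hφ, tOne, map_one, compression_one]
  · exact (isCP_compression _).comp ((isCP_starAlgHom hP.lift).comp (isCP_subtype G.TSys))
  · rw [hφ, tGen, hP.lift_projGen, hW x]
    rfl

end Representation

/-! ### Maps on `S_G` determined by the generators -/

section EdgeMap

variable {V : Type u} [Fintype V] (G : ContextualityScenario V)

lemma card_edges_ne_zero : (G.edges.card : ℂ) ≠ 0 :=
  Nat.cast_ne_zero.2 G.edges_nonempty.card_pos.ne'

section Module

variable {E F : Type*} [AddCommGroup E] [Module ℂ E] [AddCommGroup F] [Module ℂ F]

variable {G} in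
lemma edgeAlg_hom_ext {S T : G.EdgeAlg →ₗ[ℂ] E}
    (h : ∀ e x, S (G.edgeDelta e x) = T (G.edgeDelta e x)) : S = T := by
  classical
  refine LinearMap.pi_ext' fun e => LinearMap.pi_ext' fun x => LinearMap.ext_ring ?_
  convert h e x using 2 <;> simp [edgeDelta]

/-- The linear map `u ↦ |E|⁻¹ ∑_e ∑_{x ∈ e} u_x^e a_x` induced by a family `(a_x)`. -/
def edgeMap (a : V → E) : G.EdgeAlg →ₗ[ℂ] E where
  toFun u := (G.edges.card : ℂ)⁻¹ • ∑ e : G.edges, ∑ x : e.1, u e x • a x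
  map_add' u v := by simp [add_smul, Finset.sum_add_distrib]
  map_smul' c u := by simp [Finset.smul_sum, smul_smul, mul_left_comm]

lemma edgeMap_apply (a : V → E) (u : G.EdgeAlg) :
    G.edgeMap a u = (G.edges.card : ℂ)⁻¹ • ∑ e : G.edges, ∑ x : e.1, u e x • a x := rfl

lemma edgeMap_edgeDelta (a : V → E) (e : G.edges) (x : e.1) :
    G.edgeMap a (G.edgeDelta e x) = (G.edges.card : ℂ)⁻¹ • a x := by
  classical
  rw [edgeMap_apply, Finset.sum_eq_single e, Finset.sum_eq_single x]
  · simp [edgeDelta]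
  · exact fun y _ hy => by simp [edgeDelta, hy]
  · simp
  · exact fun f _ hf => by simp [edgeDelta, hf]
  · simp

lemma comp_edgeMap (T : E →ₗ[ℂ] F) (a : V → E) :
    T ∘ₗ G.edgeMap a = G.edgeMap fun x => T (a x) :=
  edgeAlg_hom_ext fun e x => by
    rw [LinearMap.comp_apply, edgeMap_edgeDelta, edgeMap_edgeDelta, map_smul]

lemma edgeMap_sGen : G.edgeMap G.sGen = G.edgeKernel.mkQ :=
  edgeAlg_hom_ext fun e x => by
    rw [edgeMap_edgeDelta, G.sGen_eq e x, inv_smul_smul₀ G.card_edges_ne_zero]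

lemma comp_mkQ_eq_edgeMap (T : G.SSys →ₗ[ℂ] E) :
    T ∘ₗ G.edgeKernel.mkQ = G.edgeMap fun x => T (G.sGen x) := by
  rw [← edgeMap_sGen, comp_edgeMap]

variable {G} in
lemma SSys_hom_ext {S T : G.SSys →ₗ[ℂ] E} (h : ∀ x, S (G.sGen x) = T (G.sGen x)) : S = T :=
  Submodule.linearMap_qext _ (by simp only [comp_mkQ_eq_edgeMap, h])

end Module

lemma pairing_one {p : V → ℝ} (hp : p ∈ G.probModels) : G.pairing p 1 = G.edges.card := by
  have hsum (e : G.edges) : ∑ x : e.1, (p x : ℂ) * (1 : G.EdgeAlg) e x = 1 := by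
    simp only [Pi.one_apply, mul_one]
    rw [Finset.sum_coe_sort e.1 fun x => (p x : ℂ), ← Complex.ofReal_sum, hp.2 e.1 e.2,
      Complex.ofReal_one]
  exact (Finset.sum_congr rfl fun e _ => hsum e).trans (by simp)

lemma sum_sGen {e : Finset V} (he : e ∈ G.edges) : ∑ x ∈ e, G.sGen x = G.sOne := by
  rw [← Finset.sum_coe_sort e, Finset.sum_congr rfl fun x _ => G.sGen_eq ⟨e, he⟩ x,
    ← Finset.smul_sum, ← map_sum, ← map_smul, sOne, ← sub_eq_zero, ← map_sub,
    Submodule.mkQ_apply, Submodule.Quotient.mk_eq_zero, mem_edgeKernel]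
  intro p hp
  rw [map_sub, map_smul, map_sum, G.pairing_one hp]
  simp only [pairing_edgeDelta]
  rw [Finset.sum_coe_sort e fun x => (p x : ℂ), ← Complex.ofReal_sum, hp.2 e he,
    Complex.ofReal_one, smul_eq_mul, mul_one, sub_self]

lemma canonicalMap_sOne : G.canonicalMap G.sOne = G.tOne := by
  obtain ⟨e, he⟩ := G.edges_nonempty
  rw [← G.sum_sGen he, map_sum]
  refine Subtype.ext ?_
  simp only [canonicalMap_sGen, Submodule.coe_sum]
  exact G.sum_projGen he

lemma canonicalMap_surjective : Function.Surjective G.canonicalMap := by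
  rw [← LinearMap.range_eq_top, eq_top_iff, ← span_range_tGen, Submodule.span_le]
  rintro _ ⟨x, rfl⟩
  exact ⟨G.sGen x, G.canonicalMap_sGen x⟩

section CP

variable {A : Type*} [CStarAlgebra A]

lemma isCP_edgeMap {a : V → A} (ha : ∀ x, ∃ b, a x = star b * b) :
    IsCP (matPos G.EdgeAlg) (matPos A) (G.edgeMap a) := by
  rintro n _ ⟨B, rfl⟩
  choose b hb using ha
  have hsum : (B.conjTranspose * B).map (G.edgeMap a) = (((G.edges.card : ℝ)⁻¹ : ℝ) : ℂ) •
      ∑ e : G.edges, ∑ x : e.1, (Matrix.of fun i j => B i j e x • b x).conjTranspose *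
        Matrix.of fun i j => B i j e x • b x := by
    ext i j
    simp only [Matrix.map_apply, edgeMap_apply, Matrix.smul_apply, Matrix.sum_apply,
      Matrix.mul_apply, Matrix.conjTranspose_apply, Matrix.of_apply, Finset.sum_apply,
      Pi.mul_apply, Pi.star_apply, star_smul, smul_mul_smul_comm, Finset.sum_smul, hb,
      Complex.ofReal_inv, Complex.ofReal_natCast]
  rw [hsum]
  exact smul_mem_matPos (by positivity)
    (sum_mem_matPos _ fun e _ => sum_mem_matPos _ fun x _ => ⟨_, rfl⟩)

lemma isCP_of_map_sGen {T : G.SSys →ₗ[ℂ] A} (hT : ∀ x, ∃ b, T (G.sGen x) = star b * b) :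
    IsCP G.sCone (matPos A) T := by
  refine fun n U hU => mem_matPos_of_forall_add_smul_mem
    (N := Matrix.diagonal fun _ => T G.sOne) fun ε hε => ?_
  obtain ⟨M, hM, hMU⟩ := hU ε hε
  have hTM : M.map (G.edgeMap fun x => T (G.sGen x)) =
      U.map T + (ε : ℂ) • Matrix.diagonal fun _ => T G.sOne := by
    rw [← comp_mkQ_eq_edgeMap, LinearMap.coe_comp, ← Matrix.map_map, hMU,
      Matrix.map_add _ (map_add T), Matrix.diagonal_map (map_zero T), ← Matrix.diagonal_smul]
    simp [Pi.smul_def]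
  exact hTM ▸ G.isCP_edgeMap hT n M hM

end CP

lemma isCP_canonicalMap : IsCP G.sCone G.tCone G.canonicalMap :=
  G.isCP_of_map_sGen (T := G.TSys.subtype ∘ₗ G.canonicalMap) fun x => ⟨G.projGen x, by
    have hproj := G.isStarProjection_projGen x
    rw [hproj.isSelfAdjoint.star_eq, hproj.isIdempotentElem.eq, LinearMap.comp_apply,
      canonicalMap_sGen]
    rfl⟩

variable {G} {H : Type*} [NormedAddCommGroup H] [InnerProductSpace ℂ H] [CompleteSpace H]

section Lift

variable {A : V → H →L[ℂ] H} (hA : G.IsPOR A)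

/-- The linear map `S_G → B(H)`, `a_x ↦ A_x`, induced by a POR. -/
def IsPOR.lift : G.SSys →ₗ[ℂ] (H →L[ℂ] H) :=
  G.edgeKernel.liftQ (G.edgeMap A) fun u hu => by
    rw [LinearMap.mem_ker, edgeMap_apply, hA.sum_eq_zero hu, smul_zero]

lemma IsPOR.lift_mkQ (u : G.EdgeAlg) : hA.lift (G.edgeKernel.mkQ u) = G.edgeMap A u := rfl

lemma IsPOR.lift_sGen (x : V) : hA.lift (G.sGen x) = A x := by
  rw [sGen, map_smul, hA.lift_mkQ, edgeMap_edgeDelta, smul_inv_smul₀ G.card_edges_ne_zero]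

lemma IsPOR.lift_sOne : hA.lift G.sOne = 1 := by
  obtain ⟨e, he⟩ := G.edges_nonempty
  rw [← G.sum_sGen he, map_sum, Finset.sum_congr rfl fun x _ => hA.lift_sGen x, hA.sum_eq e he]

lemma IsPOR.isCP_lift : IsCP G.sCone (matPos (H →L[ℂ] H)) hA.lift :=
  G.isCP_of_map_sGen fun x => nonneg_iff_exists_eq_star_mul_self.1 <| by
    rw [hA.lift_sGen]
    exact (ContinuousLinearMap.nonneg_iff_isPositive _).2 (hA.pos x)

end Lift

theorem isDilating_of_isCompleteOrderIso
    (h : IsCompleteOrderIso G.sCone G.tCone G.canonicalMap) : G.IsDilating := by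
  intro H _ _ _ A hA
  obtain ⟨-, Ψ, hΨ, -, hcp⟩ := h
  have hΨ' (s : G.SSys) : Ψ (G.canonicalMap s) = s := LinearMap.congr_fun hΨ s
  have hφ : G.IsUCP (hA.lift ∘ₗ Ψ) :=
    ⟨by rw [LinearMap.comp_apply, ← canonicalMap_sOne, hΨ', hA.lift_sOne], hA.isCP_lift.comp hcp⟩
  convert hφ.isDilatablePOR using 2 with x
  rw [← canonicalMap_sGen, LinearMap.comp_apply, hΨ', hA.lift_sGen]

end EdgeMap

/-! ### Operator-valued maps associated with functionals on matrices -/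

section Choi

variable {ι E S : Type*} [Fintype ι] [NormedAddCommGroup E] [InnerProductSpace ℂ E]

section Module

variable [DecidableEq ι] [AddCommGroup S] [Module ℂ S] (b : OrthonormalBasis ι ℂ E)
  (f : Module.Dual ℂ (Matrix ι ι S))

/-- The map `S → B(E)` associated with a functional `f` on the matrices over `S`: the
`(i, j)`-entry of `choiMap b f s` in the basis `b` is `f (e_ij ⊗ s)`. -/
def choiMap : S →ₗ[ℂ] (E →L[ℂ] E) :=
  ∑ i, ∑ j, (f ∘ₗ Matrix.singleLinearMap ℂ i j).smulRight (InnerProductSpace.rankOne ℂ (b i) (b j))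

lemma inner_choiMap (s : S) (ξ η : E) :
    ⟪ξ, choiMap b f s η⟫_ℂ = f (Matrix.of fun i j => (⟪ξ, b i⟫_ℂ * ⟪b j, η⟫_ℂ) • s) := by
  rw [Matrix.matrix_eq_sum_single (Matrix.of _)]
  simp [choiMap, ← Matrix.smul_single, mul_comm]

lemma sum_inner_choiMap (N : Matrix ι ι S) :
    ∑ i, ∑ j, ⟪b i, choiMap b f (N i j) (b j)⟫_ℂ = f N := by
  have hentry (i j : ι) : (Matrix.of fun k l => (⟪b i, b k⟫_ℂ * ⟪b l, b j⟫_ℂ) • N i j) =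
      Matrix.single i j (N i j) := by
    ext k l
    simp only [Matrix.of_apply, Matrix.single_apply, b.inner_eq_ite, ite_and, eq_comm (a := l)]
    split_ifs <;> simp
  simp only [inner_choiMap, hentry, ← map_sum]
  rw [← Matrix.matrix_eq_sum_single]

lemma choiMap_eq_zero {s : S} (h : ∀ c : ι → ι → ℂ, f (Matrix.of fun i j => c i j • s) = 0) :
    choiMap b f s = 0 :=
  ContinuousLinearMap.ext fun η => ext_inner_left ℂ fun ξ => by
    rw [inner_choiMap, h, zero_apply, inner_zero_right]

end Module

open scoped ComplexOrder in
lemma isPositive_choiMap_star_mul_self [Ring S] [StarRing S] [Algebra ℂ S] [StarModule ℂ S] {n : ℕ}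
    (b : OrthonormalBasis (Fin n) ℂ E) {f : Module.Dual ℂ (Matrix (Fin n) (Fin n) S)}
    (hf : ∀ M ∈ matPos S n, 0 ≤ f M) (s : S) : (choiMap b f (star s * s)).IsPositive := by
  refine isPositive_iff_forall_inner_nonneg.2 fun ξ => ?_
  convert hf _ (star_mul_mem_matPos fun i => ⟪b i, ξ⟫_ℂ • s) using 1
  simp only [inner_choiMap, star_smul, RCLike.star_def, inner_conj_symm, smul_mul_smul_comm]

end Choi

/-! ### Dilating scenarios -/

section Dilating

variable {V : Type u} [Fintype V] {G : ContextualityScenario V}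

lemma edgeMap_ofReal_smul {E : Type*} [AddCommGroup E] [Module ℂ E] (p : V → ℝ) (v : E)
    (u : G.EdgeAlg) :
    G.edgeMap (fun x => (p x : ℂ) • v) u = ((G.edges.card : ℂ)⁻¹ * G.pairing p u) • v := by
  simp [edgeMap_apply, pairing, mul_smul, Finset.sum_smul, mul_comm]

section PositiveMaps

variable {H : Type*} [NormedAddCommGroup H] [InnerProductSpace ℂ H] [CompleteSpace H]

lemma isPOR_smul_one {p : V → ℝ} (hp : p ∈ G.probModels) :
    G.IsPOR fun x => (p x : ℂ) • (1 : H →L[ℂ] H) where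
  pos x := by
    rw [← ContinuousLinearMap.nonneg_iff_isPositive, Complex.coe_smul]
    exact smul_nonneg (hp.1 x).1 zero_le_one
  sum_eq e he := by
    rw [← Finset.sum_smul, ← Complex.ofReal_sum, hp.2 e he, Complex.ofReal_one, one_smul]

lemma map_sOne_nonneg {T : G.SSys →ₗ[ℂ] (H →L[ℂ] H)} (hT : ∀ x, (T (G.sGen x)).IsPositive) :
    0 ≤ T G.sOne := by
  obtain ⟨e, he⟩ := G.edges_nonempty
  rw [← G.sum_sGen he, map_sum]
  exact Finset.sum_nonneg fun x _ => (ContinuousLinearMap.nonneg_iff_isPositive _).2 (hT x)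

end PositiveMaps

section Factorization

variable {H : Type u} [NormedAddCommGroup H] [InnerProductSpace ℂ H] [CompleteSpace H]

lemma IsDilating.exists_isUCP (hG : G.IsDilating) {T : G.SSys →ₗ[ℂ] (H →L[ℂ] H)}
    (hT : ∀ x, (T (G.sGen x)).IsPositive) (hT1 : T G.sOne = 1) :
    ∃ φ : G.TSys →ₗ[ℂ] (H →L[ℂ] H), G.IsUCP φ ∧ φ ∘ₗ G.canonicalMap = T := by
  have hA : G.IsPOR fun x => T (G.sGen x) :=
    ⟨hT, fun e he => by rw [← map_sum, G.sum_sGen he, hT1]⟩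
  obtain ⟨φ, hφ, hφA⟩ := (hG H _ hA).exists_isUCP
  refine ⟨φ, hφ, SSys_hom_ext fun x => ?_⟩
  rw [LinearMap.comp_apply, canonicalMap_sGen, hφA]

lemma IsDilating.canonicalMap_injective (hG : G.IsDilating) :
    Function.Injective G.canonicalMap := by
  rw [← LinearMap.ker_eq_bot, LinearMap.ker_eq_bot']
  intro s hs
  obtain ⟨u, rfl⟩ := Submodule.mkQ_surjective _ s
  rw [Submodule.mkQ_apply, Submodule.Quotient.mk_eq_zero, mem_edgeKernel]
  intro p hp
  have hA := isPOR_smul_one (H := EuclideanSpace ℂ PUnit.{u + 1}) hp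
  obtain ⟨φ, -, hφ⟩ := hG.exists_isUCP (fun x => (hA.lift_sGen x).symm ▸ hA.pos x) hA.lift_sOne
  have hzero := hA.lift_mkQ u
  rw [← hφ, LinearMap.comp_apply, hs, map_zero, edgeMap_ofReal_smul] at hzero
  simpa [G.card_edges_ne_zero] using hzero.symm

variable (G) in
/-- The matricial cones on `S_G` pulled back from `T_G` along `Φ`. -/
def canonicalCone (n : ℕ) : Set (Matrix (Fin n) (Fin n) G.SSys) :=
  {U | U.map G.canonicalMap ∈ G.tCone n}

lemma IsDilating.isCP_canonicalCone_of_map_sOne_eq_one (hG : G.IsDilating)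
    {T : G.SSys →ₗ[ℂ] (H →L[ℂ] H)} (hT : ∀ x, (T (G.sGen x)).IsPositive) (hT1 : T G.sOne = 1) :
    IsCP G.canonicalCone (matPos (H →L[ℂ] H)) T := by
  obtain ⟨φ, hφ, rfl⟩ := hG.exists_isUCP hT hT1
  exact hφ.2.comp fun n U hU => hU

lemma IsDilating.isCP_canonicalCone_of_isStrictlyPositive (hG : G.IsDilating)
    {T : G.SSys →ₗ[ℂ] (H →L[ℂ] H)} (hT : ∀ x, (T (G.sGen x)).IsPositive)
    (hT1 : IsStrictlyPositive (T G.sOne)) :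
    IsCP G.canonicalCone (matPos (H →L[ℂ] H)) T := by
  obtain ⟨R, hR⟩ := hT1.isUnit_cfcSqrt
  have hRsa : star R = R := Units.ext <| by
    rw [Units.coe_star, hR]
    exact (IsSelfAdjoint.of_nonneg (CFC.sqrt_nonneg _)).star_eq
  have hRR : T G.sOne = (R : H →L[ℂ] H) * R := by
    rw [hR, CFC.sqrt_mul_sqrt_self _ hT1.nonneg]
  have hcomp (S : (H →L[ℂ] H)ˣ) (X : H →L[ℂ] H) :
      compression (S : H →L[ℂ] H) X = (star S : (H →L[ℂ] H)ˣ) * (X * S) := rfl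
  have hunital := hG.isCP_canonicalCone_of_map_sOne_eq_one
    (T := compression (R⁻¹.val : H →L[ℂ] H) ∘ₗ T) (fun x => (hT x).adjoint_conj _) (by
      rw [LinearMap.comp_apply, hRR, hcomp, star_inv, hRsa, mul_assoc, R.mul_inv, mul_one,
        R.inv_mul])
  convert (isCP_compression (R : H →L[ℂ] H)).comp hunital using 1
  refine LinearMap.ext fun s => ?_
  simp only [LinearMap.comp_apply, hcomp, star_inv, hRsa]
  rw [mul_assoc, mul_assoc, R.inv_mul, mul_one, R.mul_inv_cancel_left]

lemma IsDilating.isCP_canonicalCone (hG : G.IsDilating) (hG' : G.IsNontrivial)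
    {T : G.SSys →ₗ[ℂ] (H →L[ℂ] H)} (hT : ∀ x, (T (G.sGen x)).IsPositive) :
    IsCP G.canonicalCone (matPos (H →L[ℂ] H)) T := by
  obtain ⟨p, hp⟩ := hG'
  have hA := isPOR_smul_one (H := H) hp
  refine fun n U hU => mem_matPos_of_forall_add_smul_mem (N := U.map hA.lift) fun δ hδ => ?_
  refine hG.isCP_canonicalCone_of_isStrictlyPositive (T := T + (δ : ℂ) • hA.lift)
    (fun x => ?_) ?_ n U hU
  · have hδA : 0 ≤ δ • hA.lift (G.sGen x) := smul_nonneg hδ.le <| by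
      rw [hA.lift_sGen]
      exact (ContinuousLinearMap.nonneg_iff_isPositive _).2 (hA.pos x)
    rw [← ContinuousLinearMap.nonneg_iff_isPositive]
    exact add_nonneg ((ContinuousLinearMap.nonneg_iff_isPositive _).2 (hT x)) hδA
  · rw [LinearMap.add_apply, LinearMap.smul_apply, hA.lift_sOne, Complex.coe_smul]
    refine IsStrictlyPositive.nonneg_add (map_sOne_nonneg hT) ⟨smul_nonneg hδ.le zero_le_one, ?_⟩
    rw [← Algebra.algebraMap_eq_smul_one]
    exact (IsUnit.mk0 δ hδ.ne').map (algebraMap ℝ (H →L[ℂ] H))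

end Factorization

section Separation

variable {n : ℕ}

lemma pairing_star (p : V → ℝ) (u : G.EdgeAlg) : G.pairing p (star u) = star (G.pairing p u) := by
  simp [pairing]

lemma star_mem_edgeKernel {u : G.EdgeAlg} (hu : u ∈ G.edgeKernel) : star u ∈ G.edgeKernel := by
  rw [mem_edgeKernel] at hu ⊢
  intro p hp
  rw [pairing_star, hu p hp, star_zero]

variable (G n) in
/-- The cone of matrices over `⊕_e ℓ^∞_e` whose hermitian part agrees with a positive matrix
modulo the kernel. The hermitian part is taken without the factor `1/2`. -/
def liftCone : PointedCone ℝ (Matrix (Fin n) (Fin n) G.EdgeAlg) where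
  carrier := {N | ∃ P ∈ matPos G.EdgeAlg n, (N + N.conjTranspose).map G.edgeKernel.mkQ =
    P.map G.edgeKernel.mkQ}
  add_mem' := by
    rintro M N ⟨P, hP, hMP⟩ ⟨Q, hQ, hNQ⟩
    refine ⟨P + Q, add_mem_matPos hP hQ, ?_⟩
    rw [Matrix.conjTranspose_add, add_add_add_comm, Matrix.map_add _ (map_add _), hMP, hNQ,
      ← Matrix.map_add _ (map_add _)]
  zero_mem' := ⟨0, zero_mem_matPos, by simp⟩
  smul_mem' := by
    rintro c N ⟨P, hP, hNP⟩
    refine ⟨((c : ℝ) : ℂ) • P, smul_mem_matPos c.2 hP, ?_⟩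
    have hc : c • N = ((c : ℝ) : ℂ) • N := rfl
    rw [hc, Matrix.conjTranspose_smul, Complex.star_def, Complex.conj_ofReal, ← smul_add,
      Matrix.map_smul _ _ (fun u => map_smul _ _ u), Matrix.map_smul _ _ (fun u => map_smul _ _ u),
      hNP]

variable {N : Matrix (Fin n) (Fin n) G.EdgeAlg}

lemma mem_liftCone_of_mem_matPos (hN : N ∈ matPos G.EdgeAlg n) : N ∈ G.liftCone n :=
  ⟨N + N, add_mem_matPos hN hN, by rw [conjTranspose_eq_of_mem_matPos hN]⟩

lemma mem_liftCone_of_conjTranspose_eq_neg (hN : N.conjTranspose = -N) : N ∈ G.liftCone n :=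
  ⟨0, zero_mem_matPos, by rw [hN, add_neg_cancel]⟩

lemma mem_liftCone_of_mem_edgeKernel (hN : ∀ i j, N i j ∈ G.edgeKernel) : N ∈ G.liftCone n := by
  refine ⟨0, zero_mem_matPos, Matrix.ext fun i j => ?_⟩
  simp only [Matrix.map_apply, Matrix.zero_apply, map_zero]
  exact (Submodule.Quotient.mk_eq_zero _).2 (add_mem (hN i j) (star_mem_edgeKernel (hN j i)))

section Functional

open scoped ComplexOrder

variable {f : Module.Dual ℂ (Matrix (Fin n) (Fin n) G.EdgeAlg)}

lemma apply_nonneg_of_mem_matPos (hf : ∀ M ∈ G.liftCone n, 0 ≤ (f M).re)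
    (hN : N ∈ matPos G.EdgeAlg n) : 0 ≤ f N := by
  -- `± i N` is skew-hermitian, hence in the cone.
  have hskew : (Complex.I • N).conjTranspose = -(Complex.I • N) := by
    rw [Matrix.conjTranspose_smul, conjTranspose_eq_of_mem_matPos hN, Complex.star_def,
      Complex.conj_I, neg_smul]
  have him := hf _ (mem_liftCone_of_conjTranspose_eq_neg hskew)
  have him' := hf _ (mem_liftCone_of_conjTranspose_eq_neg (N := -(Complex.I • N))
    (by rw [Matrix.conjTranspose_neg, hskew]))
  simp only [map_neg, map_smul, smul_eq_mul, Complex.neg_re, Complex.I_mul_re, neg_neg] at him him'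
  exact Complex.nonneg_iff.2 ⟨hf N (mem_liftCone_of_mem_matPos hN), by linarith⟩

lemma apply_eq_zero_of_mem_edgeKernel (hf : ∀ M ∈ G.liftCone n, 0 ≤ (f M).re)
    (hN : ∀ i j, N i j ∈ G.edgeKernel) : f N = 0 := by
  have hsmul (c : ℂ) : 0 ≤ (c * f N).re := by
    rw [← smul_eq_mul, ← map_smul]
    exact hf _ (mem_liftCone_of_mem_edgeKernel fun i j => Submodule.smul_mem _ _ (hN i j))
  have hnorm := hsmul (-star (f N))
  rw [neg_mul, Complex.star_def, ← Complex.normSq_eq_conj_mul_self, Complex.neg_re,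
    Complex.ofReal_re, neg_nonneg] at hnorm
  exact Complex.normSq_eq_zero.1 (hnorm.antisymm (Complex.normSq_nonneg _))

lemma star_edgeDelta_mul_self (e : G.edges) (x : e.1) :
    star (G.edgeDelta e x) * G.edgeDelta e x = G.edgeDelta e x := by
  classical
  simp [edgeDelta, ← Pi.single_mul]

lemma exists_map_of_nonneg_on_liftCone {E : Type*} [NormedAddCommGroup E] [InnerProductSpace ℂ E]
    [CompleteSpace E] (b : OrthonormalBasis (Fin n) ℂ E)
    (hf : ∀ M ∈ G.liftCone n, 0 ≤ (f M).re) :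
    ∃ T : G.SSys →ₗ[ℂ] (E →L[ℂ] E), (∀ x, (T (G.sGen x)).IsPositive) ∧
      ∀ N : Matrix (Fin n) (Fin n) G.EdgeAlg,
        ∑ i, ∑ j, ⟪b i, T (G.edgeKernel.mkQ (N i j)) (b j)⟫_ℂ = f N := by
  have hker : G.edgeKernel ≤ LinearMap.ker (choiMap b f) := fun u hu =>
    choiMap_eq_zero b f fun c => apply_eq_zero_of_mem_edgeKernel hf fun i j => by
      rw [Matrix.of_apply]
      exact Submodule.smul_mem _ _ hu
  refine ⟨G.edgeKernel.liftQ (choiMap b f) hker, fun x => ?_, sum_inner_choiMap b f⟩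
  obtain ⟨e, he, hx⟩ := G.covers x
  have hδ := isPositive_choiMap_star_mul_self b (fun M hM => apply_nonneg_of_mem_matPos hf hM)
    (G.edgeDelta ⟨e, he⟩ ⟨x, hx⟩)
  rw [star_edgeDelta_mul_self, ← ContinuousLinearMap.nonneg_iff_isPositive] at hδ
  rw [G.sGen_eq ⟨e, he⟩ ⟨x, hx⟩, map_smul, Submodule.mkQ_apply, Submodule.liftQ_apply,
    ← ContinuousLinearMap.nonneg_iff_isPositive, ← Complex.ofReal_natCast, Complex.coe_smul]
  exact smul_nonneg (Nat.cast_nonneg _) hδ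

end Functional

instance : LocallyConvexSpace ℝ (Matrix (Fin n) (Fin n) G.EdgeAlg) :=
  inferInstanceAs (LocallyConvexSpace ℝ (Fin n → Fin n → G.EdgeAlg))

lemma IsDilating.mem_closure_liftCone (hG : G.IsDilating) (hG' : G.IsNontrivial)
    (hN : N.map G.edgeKernel.mkQ ∈ G.canonicalCone n) :
    N ∈ closure (G.liftCone n : Set (Matrix (Fin n) (Fin n) G.EdgeAlg)) := by
  by_contra hcl
  obtain ⟨g, hg, hgN⟩ := ProperCone.hyperplane_separation_point
    (Submodule.closure (G.liftCone n)) (x₀ := N) hcl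
  let f : Module.Dual ℂ (Matrix (Fin n) (Fin n) G.EdgeAlg) :=
    Module.Dual.extendRCLike (g : _ →ₗ[ℝ] ℝ)
  have hfg (M : Matrix (Fin n) (Fin n) G.EdgeAlg) : (f M).re = g M :=
    Module.Dual.re_extendRCLike_apply (𝕜 := ℂ) (g : _ →ₗ[ℝ] ℝ) M
  let b := (EuclideanSpace.basisFun (ULift.{u} (Fin n)) ℂ).reindex Equiv.ulift
  obtain ⟨T, hT, hTf⟩ := exists_map_of_nonneg_on_liftCone (f := f) b
    fun M hM => (hfg M).symm ▸ hg M (subset_closure hM)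
  have hpos := mem_matPos_iff_forall_sum_inner_nonneg.1 (hG.isCP_canonicalCone hG' hT n _ hN) b
  simp only [Matrix.map_apply, hTf] at hpos
  exact hgN.not_ge (hfg N ▸ (Complex.nonneg_iff.1 hpos).1)

lemma edgeMap_star {E : Type*} [AddCommGroup E] [StarAddMonoid E] [Module ℂ E] [StarModule ℂ E]
    {a : V → E} (ha : ∀ x, IsSelfAdjoint (a x)) (u : G.EdgeAlg) :
    G.edgeMap a (star u) = star (G.edgeMap a u) := by
  simp [edgeMap_apply, star_sum, (ha _).star_eq]

lemma coe_canonicalMap_mkQ (u : G.EdgeAlg) :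
    (G.canonicalMap (G.edgeKernel.mkQ u) : G.CStar) = G.edgeMap G.projGen u := by
  have h := LinearMap.congr_fun (G.comp_mkQ_eq_edgeMap (G.TSys.subtype ∘ₗ G.canonicalMap)) u
  simp only [LinearMap.comp_apply, canonicalMap_sGen] at h
  exact h

lemma conjTranspose_map_mkQ_of_mem_canonicalCone (hinj : Function.Injective G.canonicalMap)
    (hN : N.map G.edgeKernel.mkQ ∈ G.canonicalCone n) :
    N.conjTranspose.map G.edgeKernel.mkQ = N.map G.edgeKernel.mkQ := by
  refine Matrix.ext fun i j => hinj (Subtype.ext ?_)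
  have hij := congrFun (congrFun (conjTranspose_eq_of_mem_matPos hN) i) j
  simp only [Matrix.conjTranspose_apply, Matrix.map_apply, coe_canonicalMap_mkQ] at hij ⊢
  rw [edgeMap_star fun x => (G.isStarProjection_projGen x).isSelfAdjoint, hij]

lemma map_mkQ_mem_sCone_of_mem_closure_liftCone
    (hherm : N.conjTranspose.map G.edgeKernel.mkQ = N.map G.edgeKernel.mkQ)
    (hcl : N ∈ closure (G.liftCone n : Set (Matrix (Fin n) (Fin n) G.EdgeAlg))) :
    N.map G.edgeKernel.mkQ ∈ G.sCone n := by
  intro ε hε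
  have hcont : Continuous fun N' => N - N' := by fun_prop
  have hnear := (hcont.tendsto' N 0 (sub_self N)).eventually
    (eventually_add_conjTranspose_add_diagonal_mem_matPos (mul_pos two_pos hε))
  obtain ⟨N', hN', P, hP, hNP⟩ := mem_closure_iff_nhds.1 hcl _ hnear
  refine ⟨((1 / 2 : ℝ) : ℂ) • (P + _), smul_mem_matPos (by norm_num) (add_mem_matPos hP hN'), ?_⟩
  ext i j
  have hPij := congrFun (congrFun hNP i) j
  have hij := congrFun (congrFun hherm i) j
  have hdiag : G.edgeKernel.mkQ (Matrix.diagonal (fun _ => ((2 * ε : ℝ) : ℂ) • (1 : G.EdgeAlg)) i j)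
      = (2 : ℂ) • Matrix.diagonal (fun _ => (ε : ℂ) • G.sOne) i j := by
    simp only [Matrix.diagonal_apply, apply_ite G.edgeKernel.mkQ, map_smul, map_zero, smul_ite,
      smul_zero, smul_smul, sOne, Complex.ofReal_mul, Complex.ofReal_ofNat]
  simp only [Matrix.map_apply, Matrix.add_apply, Matrix.smul_apply, Matrix.sub_apply,
    Matrix.conjTranspose_apply, map_add, map_smul, star_sub, map_sub] at hPij hij ⊢
  rw [hdiag, ← hPij, hij]
  push_cast
  module

lemma IsDilating.canonicalCone_subset_sCone (hG : G.IsDilating) (hG' : G.IsNontrivial) (n : ℕ) :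
    G.canonicalCone n ⊆ G.sCone n := by
  intro U hU
  obtain ⟨N, rfl⟩ : ∃ N : Matrix (Fin n) (Fin n) G.EdgeAlg, N.map G.edgeKernel.mkQ = U := by
    choose N hN using fun i j => Submodule.mkQ_surjective G.edgeKernel (U i j)
    exact ⟨Matrix.of N, Matrix.ext hN⟩
  exact map_mkQ_mem_sCone_of_mem_closure_liftCone
    (conjTranspose_map_mkQ_of_mem_canonicalCone hG.canonicalMap_injective hU)
    (hG.mem_closure_liftCone hG' hU)

end Separation

theorem IsDilating.isCompleteOrderIso (hG : G.IsDilating) (hG' : G.IsNontrivial) :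
    IsCompleteOrderIso G.sCone G.tCone G.canonicalMap := by
  let Ψ := LinearEquiv.ofBijective G.canonicalMap
    ⟨hG.canonicalMap_injective, G.canonicalMap_surjective⟩
  have hΨ (t : G.TSys) : G.canonicalMap (Ψ.symm t) = t := Ψ.apply_symm_apply t
  refine ⟨G.isCP_canonicalMap, Ψ.symm, LinearMap.ext Ψ.symm_apply_apply, LinearMap.ext hΨ,
    fun n M hM => hG.canonicalCone_subset_sCone hG' n ?_⟩
  have hM' : (M.map Ψ.symm).map G.canonicalMap = M := Matrix.ext fun i j => hΨ (M i j)
  exact show (M.map Ψ.symm).map G.canonicalMap ∈ G.tCone n from hM'.symm ▸ hM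

end Dilating

end ContextualityScenario

end

theorem mainTheorem7 {V : Type u} [Fintype V] (G : ContextualityScenario V)
    (hG : G.IsNontrivial) :
    (G.IsDilating ↔
      ContextualityScenario.IsCompleteOrderIso G.sCone G.tCone G.canonicalMap) ∧
    (∀ (H : Type u) [NormedAddCommGroup H] [InnerProductSpace ℂ H] [CompleteSpace H],
      (∀ φ : G.TSys →ₗ[ℂ] (H →L[ℂ] H), G.IsUCP φ →
        G.IsDilatablePOR (fun x => φ (G.tGen x))) ∧
      (∀ A : V → H →L[ℂ] H, G.IsDilatablePOR A →
        ∃! φ : G.TSys →ₗ[ℂ] (H →L[ℂ] H), G.IsUCP φ ∧ ∀ x, φ (G.tGen x) = A x)) := by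
  refine ⟨⟨fun h => h.isCompleteOrderIso hG,
    ContextualityScenario.isDilating_of_isCompleteOrderIso⟩, fun H _ _ _ =>
    ⟨fun φ hφ => hφ.isDilatablePOR, fun A hA => ?_⟩⟩
  obtain ⟨φ, hφ, hφA⟩ := hA.exists_isUCP
  exact ⟨φ, ⟨hφ, hφA⟩, fun ψ hψ =>
    ContextualityScenario.TSys_hom_ext fun x => (hψ.2 x).trans (hφA x).symm⟩
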